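/- Let $d\ge 3$. Let $D$ be a distribution on $\mathbb S^{d-1}\times\{-1,+1\}$ whose marginal on the unit sphere $\mathbb S^{d-1}$ is uniform, and for unit vectors $v,w$ let $\theta(v,w)=\arccos(v\cdot w)$. Unlabeled examples $x$ are drawn independently from the marginal of $D$, and a labeling oracle returns, when queried at a drawn $x$, a label $y$ distributed as $Y$ given $X=x$, where $(X,Y)\sim D$. The procedure MODIFIED-PERCEPTRON with initial unit vector $w_0$, number of iterations $m$ and band width $b$ does the following for $t=0,\dots,m-1$: it draws unlabeled examples until it obtains one, $x_t$, with $\frac b2\le w_t\cdot x_t\le b$; it queries the label $y_t$ of $x_t$; and it sets $w_{t+1}=w_t-2\,\mathbf 1\{y_t\,(w_t\cdot x_t)<0\}\,(w_t\cdot x_t)\,x_t$. It returns $w_m$. Running time is counted in unit-cost arithmetic operations, comparisons and assignments of real numbers, where drawing an example costs $d$ steps and a label query costs one step. There is an absolute constant $C>0$ such that the following holds. Let $u,w_0\in\mathbb S^{d-1}$, $\theta\in(0,\frac\pi2]$ with $\theta(w_0,u)\le\theta$, and $\delta\in(0,1)$. Put $$m=\left\lceil(3200\pi)^3 d\,\ln\frac{(3200\pi)^3d}{\delta}\right\rceil,\qquad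 b=\frac{1}{2(600\pi)^2\ln\frac{m^2}{\delta}}\cdot\frac{\theta}{\sqrt d}.$$ Suppose that the $\nu$-adversarial noise condition holds with respect to $u$, that is, $\mathbb P_{(X,Y)\sim D}[Y\ne\operatorname{sign}(u\cdot X)]\le\nu$, for some $\nu\in[0,1]$ with $$\nu\le\frac{\theta}{384(600\pi)^4\ln\frac{m^2}{\delta}}.$$ Then with probability at least $1-\delta$ the procedure, run with $w_0,m,b$, terminates and all of the following hold: 1. the output satisfies $\theta(w_m,u)\le\frac\theta2$; 2. the number of label queries is at most $C\,d\left(\ln d+\ln\frac1\delta\right)$; 3. the number of unlabeled examples drawn is at most $C\,d\left(\ln d+\ln\frac1\delta\right)^2\frac1\theta$; 4. the running time is at most $C\,d^2\left(\ln d+\ln\frac1\delta\right)^2\frac1\theta$. -/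

import Mathlib

open MeasureTheory ProbabilityTheory

noncomputable section

namespace ActivePerceptron

/-- The instance space: the unit sphere of `ℝ^d`. -/
abbrev Instance (d : ℕ) : Type := Metric.sphere (0 : EuclideanSpace ℝ (Fin d)) 1

/-- Labels: `true` is `+1` and `false` is `-1`. -/
abbrev Label : Type := Bool

/-- The numerical value of a label. -/
def Label.val (y : Label) : ℝ := if y then 1 else -1

/-- Labelled examples. -/
abbrev Example (d : ℕ) : Type := Instance d × Label

/-- The uniform probability distribution on the unit sphere: normalized surface measure. -/
def uniformSphere (d : ℕ) : Measure (Instance d) :=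
  ((volume : Measure (EuclideanSpace ℝ (Fin d))).toSphere Set.univ)⁻¹ •
    (volume : Measure (EuclideanSpace ℝ (Fin d))).toSphere

/-- The homogeneous halfspace classifier `x ↦ sign (u ⬝ x)`
(the value at `u ⬝ x = 0`, an event of probability zero, is taken to be `+1`). -/
def halfspace {d : ℕ} (u x : Instance d) : Label :=
  open Classical in decide (0 ≤ inner ℝ (u : EuclideanSpace ℝ (Fin d)) x)

/-- The `ν`-adversarial noise condition with respect to `u`, for the law `D` of `(X, Y)`:
`ν ∈ [0, 1]` and `ℙ[Y ≠ sign (u ⬝ X)] ≤ ν`. -/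
def AdversarialNoise {d : ℕ} (D : Measure (Example d)) (u : Instance d) (ν : ℝ) : Prop :=
  0 ≤ ν ∧ ν ≤ 1 ∧ D {z | z.2 ≠ halfspace u z.1} ≤ ENNReal.ofReal ν

/-! ### The computation model

A unit-cost real random access machine that reads a stream of examples.  Programs are built from
the primitives `step`, `add`, `sub`, `mul`, `half`, `le`, `lt`, `write`, `draw` and `query`; the
resource counters are changed only by these primitives. -/

/-- Resources used so far: unlabelled examples drawn, labels queried, elementary steps. -/
structure Resources where
  draws : ℕ
  labels : ℕ
  time : ℕ

/-- The `i`-th term of the data stream is the `i`-th example `(x, y)`; the label is hidden until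
it is queried. -/
abbrev Data (d : ℕ) : Type := ℕ → Example d

/-- Programs that have access to the data stream and count their resources; `none` is
non-termination. -/
abbrev Prog (d : ℕ) : Type → Type := ReaderT (Data d) (StateT Resources Option)

/-- Coordinate arrays of length `d`. -/
abbrev Vec (d : ℕ) : Type := Fin d → ℝ

variable {d : ℕ}

/-- Spend `k` elementary steps. -/
def step (k : ℕ) : Prog d Unit :=
  fun _ r => some ((), { r with time := r.time + k })

/-- Real addition, one step. -/
def add (a b : ℝ) : Prog d ℝ := do step 1; return a + b

/-- Real subtraction, one step. -/
def sub (a b : ℝ) : Prog d ℝ := do step 1; return a - b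

/-- Real multiplication, one step. -/
def mul (a b : ℝ) : Prog d ℝ := do step 1; return a * b

/-- Halving, one step. -/
def half (a : ℝ) : Prog d ℝ := do step 1; return a / 2

/-- Comparison `a ≤ b`, one step. -/
def le (a b : ℝ) : Prog d Bool := do step 1; return (open Classical in decide (a ≤ b))

/-- Comparison `a < b`, one step. -/
def lt (a b : ℝ) : Prog d Bool := do step 1; return (open Classical in decide (a < b))

/-- Overwrite one coordinate of an array, one step. -/
def write (v : Vec d) (i : Fin d) (a : ℝ) : Prog d (Vec d) := do
  step 1; return Function.update v i a

/-- Draw the next unlabelled example; one step for each coordinate. Returns the position of the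
example in the stream and its coordinates. -/
def draw : Prog d (ℕ × Vec d) := fun data r =>
  some ((r.draws, fun i => ((data r.draws).1 : EuclideanSpace ℝ (Fin d)) i),
    { r with draws := r.draws + 1, time := r.time + d })

/-- Query the labelling oracle for the label of the example drawn at position `n`, one step. -/
def query (n : ℕ) : Prog d ℝ := fun data r =>
  some ((data n).2.val, { r with labels := r.labels + 1, time := r.time + 1 })

/-- The inner product `w ⬝ x`, computed by a loop over the coordinates. -/
def dot (w x : Vec d) : Prog d ℝ :=
  (List.finRange d).foldlM (init := 0) fun s i => do
    step 1
    let p ← mul (w i) (x i)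
    add s p

/-- The vector `w - c x`, computed by a loop over the coordinates. -/
def subScaled (w : Vec d) (c : ℝ) (x : Vec d) : Prog d (Vec d) :=
  (List.finRange d).foldlM (init := w) fun v i => do
    step 1
    let p ← mul c (x i)
    let a ← sub (v i) p
    write v i a

/-- The test `b / 2 ≤ s ≤ b`. -/
def inBand (b s : ℝ) : Prog d Bool := do
  let h ← half b
  if ← le h s then le s b else return false

/-- Run `body` at most `k` times, until it returns a value; `none` if it never does. -/
def repeatAtMost {α : Type} (body : Prog d (Option α)) : ℕ → Prog d α
  | 0 => fun _ _ => none
  | k + 1 => do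
    match ← body with
    | some a => return a
    | none => repeatAtMost body k

/-- The unbounded loop: run `body` until it returns a value. (The run with a bound on the number of
rounds does not depend on the bound as soon as it ends within it.) -/
def repeatUntil {α : Type} (body : Prog d (Option α)) : Prog d α := fun data r =>
  open Classical in
  if h : ∃ k, repeatAtMost body k data r ≠ none then repeatAtMost body (Nat.find h) data r
  else none

/-- Rejection sampling: draw examples until one lies in `{x | b / 2 ≤ w ⬝ x ≤ b}`. Returns the
position and the coordinates of the accepted example, and the value of `w ⬝ x`. -/
def rejectionSample (b : ℝ) (w : Vec d) : Prog d (ℕ × Vec d × ℝ) :=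
  repeatUntil do
    step 1
    let (n, x) ← draw
    let s ← dot w x
    if ← inBand b s then return some (n, x, s) else return none

/-- One iteration: sample `x` from the band, query its label `y`, and replace `w` by
`w - 2 𝟙{y (w ⬝ x) < 0} (w ⬝ x) x`. -/
def iteration (b : ℝ) (w : Vec d) : Prog d (Vec d) := do
  let (n, x, s) ← rejectionSample b w
  let y ← query n
  let p ← mul y s
  if ← lt p 0 then
    let c ← mul 2 s
    subScaled w c x
  else
    return w

/-- The modified Perceptron procedure with `m` iterations and band width `b`, started from `w`. -/
def modifiedPerceptron (b : ℝ) : (m : ℕ) → (w : Vec d) → Prog d (Vec d)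
  | 0, w => return w
  | m + 1, w => do
    step 1
    let w' ← iteration b w
    modifiedPerceptron b m w'

/-- The procedure started from the unit vector `w₀`, on the given data and with no resources used,
terminates with output `w` and total resources `r`. -/
def Runs (m : ℕ) (b : ℝ) (w₀ : Instance d) (data : Data d)
    (w : EuclideanSpace ℝ (Fin d)) (r : Resources) : Prop :=
  modifiedPerceptron b m (fun i => (w₀ : EuclideanSpace ℝ (Fin d)) i) data ⟨0, 0, 0⟩ =
    some (WithLp.ofLp w, r)

end ActivePerceptron

end

open MeasureTheory ProbabilityTheory

noncomputable section

namespace ActivePerceptron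

/-! The proof follows the potential `gap u w = 1 - w ⬝ u`. With `G = 1 - cos θ` the run starts at a
gap of at most `G`, and a final gap of at most `G / 4` suffices, because `1 - cos θ ≤ 4 (1 - cos (θ
/ 2))`. A nontrivial update is a reflection of `w`, so `w` stays a unit vector.

One accepted example: since `2 (w ⬝ x) ≥ b` in the band, a correctly labelled mistake lowers the gap
by at least `b |u ⬝ x|`. Write `u = c w + a v` with `v` a unit vector orthogonal to `w`.
Conditionally on the band, `v ⬝ x` has mean zero and mean absolute value at least `1 / (2 √(d -
1))`; this follows from its second and fourth moments, which rotation invariance computes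
(`le_setIntegral_band_abs_inner`). As `b` is small against `q = a / √(d - 1)`, the gap falls by at
least `b q / 8` on average. Wrong labels cost little, because their total mass is a small fraction
of the mass of the band, which is at least `b √d / 30` (`le_uniformSphere_band`). Together with a
second moment of order `(b q)²` this makes an exponential moment of the gap contract
(`setIntegral_exp_gap_update_sub_le`) as long as the gap lies between `G / 8` and `3 G / 2`.

The whole run: every draw, rejected or accepted, is one step of a Markov chain on pairs (vector,
iterations left). The function `failureBound` of the state and of the number of draws left is at
least 1 at each failed final state and does not increase in mean along the chain, so its initial
value bounds the failure probability (`le_measure_trajectory_success`). Its terms account for ending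
above `G / 4`, for escaping above `3 G / 2`, for visits below `G / 8` where no drift is available,
and for running out of draws. No conditioning on acceptance times is needed.

Finally `modifiedPerceptron_apply_of_trajectory` transfers the chain to the actual program with its
costs, and `potential_add_budgetBound_le` and `resource_bounds` check the constants. -/

/-- The ambient Euclidean space of the sphere `Instance d`. -/
abbrev Amb (d : ℕ) : Type := EuclideanSpace ℝ (Fin d)

/-! ### Rotation invariance of the uniform measure and of its restriction to a band. -/

/-- A linear isometry of the ambient space, acting on the unit sphere. -/
def sphereEquiv {d : ℕ} (e : Amb d ≃ₗᵢ[ℝ] Amb d) : Instance d ≃ₜ Instance d where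
  toFun x := ⟨e x, by simp⟩
  invFun x := ⟨e.symm x, by simp⟩
  left_inv x := by ext1; simp
  right_inv x := by ext1; simp
  continuous_toFun := by fun_prop
  continuous_invFun := by fun_prop

@[simp]
lemma coe_sphereEquiv {d : ℕ} (e : Amb d ≃ₗᵢ[ℝ] Amb d) (x : Instance d) :
    (sphereEquiv e x : Amb d) = e x := rfl

-- The surface measure of a set is a multiple of the volume of the cone over it; a linear isometry
-- preserves volume and maps cones to cones.
open scoped Pointwise in
lemma measurePreserving_sphereEquiv {d : ℕ} (e : Amb d ≃ₗᵢ[ℝ] Amb d) :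
    MeasurePreserving (sphereEquiv e) (uniformSphere d) (uniformSphere d) := by
  refine ⟨(sphereEquiv e).continuous.measurable, ?_⟩
  rw [uniformSphere, Measure.map_smul]
  congr 1
  ext s hs
  rw [Measure.map_apply (sphereEquiv e).continuous.measurable hs, Measure.toSphere_apply' _ hs,
    Measure.toSphere_apply' _ ((sphereEquiv e).continuous.measurable hs)]
  congr 1
  conv_rhs => rw [← e.measurePreserving.measure_preimage_equiv
    (f := e.toHomeomorph.toMeasurableEquiv)]
  congr 1
  ext x
  simp only [Set.mem_smul, Set.mem_image, Set.mem_preimage]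
  change _ ↔ ∃ r ∈ Set.Ioo (0 : ℝ) 1, ∃ y, (∃ x ∈ s, (x : Amb d) = y) ∧ r • y = e x
  constructor
  · rintro ⟨r, hr, _, ⟨y, hy, rfl⟩, rfl⟩
    exact ⟨r, hr, _, ⟨_, hy, rfl⟩, by simp⟩
  · rintro ⟨r, hr, _, ⟨y, hy, rfl⟩, h⟩
    refine ⟨r, hr, _, ⟨(sphereEquiv e).symm y, by simpa using hy, rfl⟩, ?_⟩
    apply e.injective
    rw [← h, map_smul, ← coe_sphereEquiv, Homeomorph.apply_symm_apply]

lemma isProbabilityMeasure_uniformSphere {d : ℕ} (hd : 0 < d) :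
    IsProbabilityMeasure (uniformSphere d) := by
  have : Nontrivial (Amb d) := by
    have : Nonempty (Fin d) := ⟨⟨0, hd⟩⟩
    infer_instance
  constructor
  rw [uniformSphere, Measure.smul_apply, smul_eq_mul]
  refine ENNReal.inv_mul_cancel ?_ (measure_ne_top _ _)
  simp only [ne_eq, Measure.measure_univ_eq_zero]
  exact Measure.toSphere_ne_zero _

/-- The band `{x | b / 2 ≤ w ⬝ x ≤ b}` of the sphere. -/
def band {d : ℕ} (b : ℝ) (w : Amb d) : Set (Instance d) :=
  {x | b / 2 ≤ inner ℝ w (x : Amb d) ∧ inner ℝ w (x : Amb d) ≤ b}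

lemma measurableSet_band {d : ℕ} (b : ℝ) (w : Amb d) : MeasurableSet (band b w) := by
  apply MeasurableSet.inter
  · exact measurableSet_le measurable_const (g := fun x : Instance d => inner ℝ w (x : Amb d))
      (by fun_prop)
  · exact measurableSet_le (f := fun x : Instance d => inner ℝ w (x : Amb d))
      (by fun_prop) measurable_const

lemma sphereEquiv_preimage_band {d : ℕ} (b : ℝ) (e : Amb d ≃ₗᵢ[ℝ] Amb d) (w : Amb d) :
    sphereEquiv e ⁻¹' band b (e w) = band b w := by
  ext x; simp [band]

/-- The reflection that exchanges `w` and `w'` maps one band to the other. This permits computing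
with a coordinate axis in place of `w`. -/
lemma uniformSphere_band_eq {d : ℕ} (b : ℝ) {w w' : Amb d} (h : ‖w‖ = ‖w'‖) :
    uniformSphere d (band b w) = uniformSphere d (band b w') := by
  set e := Submodule.reflection (ℝ ∙ (w - w'))ᗮ
  have he : e w = w' := Submodule.reflection_sub h
  rw [← sphereEquiv_preimage_band b e, he]
  exact (measurePreserving_sphereEquiv e).measure_preimage
    (measurableSet_band b w').nullMeasurableSet

lemma setIntegral_band_isometry {d : ℕ} (b : ℝ) (w : Amb d) (e : Amb d ≃ₗᵢ[ℝ] Amb d)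
    (he : e w = w) (f : Instance d → ℝ) :
    ∫ x in band b w, f (sphereEquiv e x) ∂uniformSphere d =
      ∫ x in band b w, f x ∂uniformSphere d := by
  have := (measurePreserving_sphereEquiv e).setIntegral_preimage_emb
    (sphereEquiv e).measurableEmbedding f (band b w)
  rw [← this]
  conv_rhs => rw [← he]
  rw [sphereEquiv_preimage_band]

/-- Conditionally on the band around `w`, all directions orthogonal to `w` are alike. -/
lemma setIntegral_band_inner_eq {d : ℕ} (b : ℝ) {w v v' : Amb d} (h : ‖v‖ = ‖v'‖)
    (hv : inner ℝ w v = 0) (hv' : inner ℝ w v' = 0) (f : ℝ → ℝ) :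
    ∫ x in band b w, f (inner ℝ v (x : Amb d)) ∂uniformSphere d =
      ∫ x in band b w, f (inner ℝ v' (x : Amb d)) ∂uniformSphere d := by
  set e := Submodule.reflection (ℝ ∙ (v - v'))ᗮ with he_def
  have he : e v = v' := Submodule.reflection_sub h
  -- The reflection exchanging `v` and `v'` fixes `w`, which is orthogonal to `v - v'`, so it
  -- preserves the band.
  have hw : e w = w := by
    apply Submodule.reflection_mem_subspace_eq_self
    rw [Submodule.mem_orthogonal_singleton_iff_inner_left, inner_sub_right, hv, hv', sub_zero]
  rw [← setIntegral_band_isometry b w e hw (fun x => f (inner ℝ v' (x : Amb d)))]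
  refine integral_congr_ae (Filter.Eventually.of_forall fun x => ?_)
  simp only [coe_sphereEquiv]
  rw [← he, LinearIsometryEquiv.inner_map_map]

lemma integrable_inner_band {d : ℕ} (hd : 0 < d) (b : ℝ) (w : Amb d) {f : Amb d → ℝ}
    (hf : Continuous f) : 
    Integrable (fun x : Instance d => f x) ((uniformSphere d).restrict (band b w)) := by
  have := isProbabilityMeasure_uniformSphere hd
  have hc : Continuous fun x : Instance d => f x := hf.comp continuous_subtype_val
  obtain ⟨M, hM⟩ := (isCompact_univ (X := Instance d)).exists_bound_of_continuousOn hc.continuousOn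
  exact Integrable.of_bound hc.aestronglyMeasurable M
    (Filter.Eventually.of_forall fun x => hM x (Set.mem_univ _))

/-! ### Second and fourth moments of orthogonal projections in a band. -/

lemma exists_orthonormalBasis_apply_eq {d : ℕ} (i₀ : Fin d) {w : Amb d} (hw : ‖w‖ = 1) :
    ∃ e : OrthonormalBasis (Fin d) ℝ (Amb d), e i₀ = w := by
  have : Orthonormal ℝ (({i₀} : Set (Fin d)).domRestrict (fun _ => w)) := by
    constructor
    · exact fun _ => hw
    · rintro ⟨i, hi⟩ ⟨j, hj⟩ hij
      simp only [Set.mem_singleton_iff] at hi hj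
      subst hi; subst hj; exact absurd rfl hij
  obtain ⟨e, he⟩ := this.exists_orthonormalBasis_extension_of_card_eq (by simp)
  exact ⟨e, he i₀ rfl⟩

lemma sum_erase_inner_sq {d : ℕ} (i₀ : Fin d) (e : OrthonormalBasis (Fin d) ℝ (Amb d))
    (x : Instance d) :
    ∑ i ∈ Finset.univ.erase i₀, inner ℝ (e i) (x : Amb d) ^ 2 =
      1 - inner ℝ (e i₀) (x : Amb d) ^ 2 := by
  have h := e.sum_sq_inner_right (x : Amb d)
  have hx : ‖(x : Amb d)‖ = 1 := by simp
  rw [hx, ← Finset.add_sum_erase _ _ (Finset.mem_univ i₀)] at h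
  linarith

/-- Complete `w` to an orthonormal basis: the other `d - 1` directions have equal second moments,
and their squares sum to `1 - (w ⬝ x)²`. -/
lemma mul_setIntegral_band_inner_sq {d : ℕ} (hd : 0 < d) (b : ℝ) {w v : Amb d} (hw : ‖w‖ = 1)
    (hv : ‖v‖ = 1) (hwv : inner ℝ w v = 0) :
    ((d : ℝ) - 1) * ∫ x in band b w, inner ℝ v (x : Amb d) ^ 2 ∂uniformSphere d =
      ∫ x in band b w, (1 - inner ℝ w (x : Amb d) ^ 2) ∂uniformSphere d := by
  obtain ⟨e, he⟩ := exists_orthonormalBasis_apply_eq ⟨0, hd⟩ hw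
  set i₀ : Fin d := ⟨0, hd⟩
  have h1 : ∀ x : Instance d, 1 - inner ℝ w (x : Amb d) ^ 2 =
      ∑ i ∈ Finset.univ.erase i₀, inner ℝ (e i) (x : Amb d) ^ 2 := fun x => by
    rw [sum_erase_inner_sq, he]
  simp_rw [h1]
  rw [integral_finsetSum _ fun i _ =>
    integrable_inner_band hd b w (f := fun x => inner ℝ (e i) x ^ 2) (by fun_prop)]
  rw [Finset.sum_congr rfl (g := fun _ => ∫ x in band b w, inner ℝ v (x : Amb d) ^ 2
    ∂uniformSphere d)]
  · rw [Finset.sum_const, Finset.card_erase_of_mem (Finset.mem_univ _), nsmul_eq_mul,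
      Finset.card_univ, Fintype.card_fin, Nat.cast_sub hd, Nat.cast_one]
  · intro i hi
    refine setIntegral_band_inner_eq b (by simp [hv]) ?_ hwv (fun t => t ^ 2)
    rw [← he]
    exact e.orthonormal.2 (Finset.ne_of_mem_erase hi).symm

/-- The directions `(v₁ ± v₂) / √2` have the same fourth moment as `v₁` and `v₂`. Adding the two
expansions cancels the odd terms and leaves one linear equation for the mixed moment. -/
lemma setIntegral_band_inner_sq_mul_inner_sq {d : ℕ} (hd : 0 < d) (b : ℝ) {w v₁ v₂ v : Amb d}
    (h₁ : ‖v₁‖ = 1) (h₂ : ‖v₂‖ = 1) (hv : ‖v‖ = 1) (hw₁ : inner ℝ w v₁ = 0)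
    (hw₂ : inner ℝ w v₂ = 0) (hwv : inner ℝ w v = 0) (h : inner ℝ v₁ v₂ = 0) :
    ∫ x in band b w, inner ℝ v₁ (x : Amb d) ^ 2 * inner ℝ v₂ (x : Amb d) ^ 2 ∂uniformSphere d =
      (∫ x in band b w, inner ℝ v (x : Amb d) ^ 4 ∂uniformSphere d) / 3 := by
  set M := ∫ x in band b w, inner ℝ v (x : Amb d) ^ 4 ∂uniformSphere d with hM
  have hsq : (√2)⁻¹ ^ 2 = (1 / 2 : ℝ) := by rw [inv_pow, Real.sq_sqrt (by norm_num)]; norm_num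
  have key : ∀ v' : Amb d, ‖v'‖ = 1 → inner ℝ w v' = 0 →
      ∫ x in band b w, inner ℝ v' (x : Amb d) ^ 4 ∂uniformSphere d = M := fun v' h' hw' =>
    setIntegral_band_inner_eq b (by rw [h', hv]) hw' hwv (fun t => t ^ 4)
  have hI : ∀ v' : Amb d, Integrable (fun x : Instance d => inner ℝ v' (x : Amb d) ^ 4)
      ((uniformSphere d).restrict (band b w)) := fun v' =>
    integrable_inner_band hd b w (f := fun x => inner ℝ v' x ^ 4) (by fun_prop)
  have hI2 : Integrable (fun x : Instance d => inner ℝ v₁ (x : Amb d) ^ 2 *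
      inner ℝ v₂ (x : Amb d) ^ 2) ((uniformSphere d).restrict (band b w)) :=
    integrable_inner_band hd b w (f := fun x => inner ℝ v₁ x ^ 2 * inner ℝ v₂ x ^ 2) (by fun_prop)
  have hn1 : ‖(√2)⁻¹ • (v₁ + v₂)‖ = 1 := by
    rw [← sq_eq_sq₀ (norm_nonneg _) zero_le_one, norm_smul, mul_pow, norm_add_sq_real, h₁, h₂, h,
      Real.norm_eq_abs, sq_abs, hsq]
    norm_num
  have hn2 : ‖(√2)⁻¹ • (v₁ - v₂)‖ = 1 := by
    rw [← sq_eq_sq₀ (norm_nonneg _) zero_le_one, norm_smul, mul_pow, norm_sub_sq_real, h₁, h₂, h,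
      Real.norm_eq_abs, sq_abs, hsq]
    norm_num
  have e1 := key _ hn1 (by simp [inner_smul_right, inner_add_right, hw₁, hw₂])
  have e2 := key _ hn2 (by simp [inner_smul_right, inner_sub_right, hw₁, hw₂])
  have e3 := key _ h₁ hw₁
  have e4 := key _ h₂ hw₂
  have e5 : ∫ x in band b w, inner ℝ ((√2)⁻¹ • (v₁ + v₂)) (x : Amb d) ^ 4 +
      inner ℝ ((√2)⁻¹ • (v₁ - v₂)) (x : Amb d) ^ 4 ∂uniformSphere d = M + M := by
    rw [integral_add (hI _) (hI _), e1, e2]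
  have hq : (√2)⁻¹ ^ 4 = (1 / 4 : ℝ) := by
    rw [show (√2)⁻¹ ^ 4 = ((√2)⁻¹ ^ 2) ^ 2 by ring, hsq]; norm_num
  have e6 : ∀ x : Instance d, inner ℝ ((√2)⁻¹ • (v₁ + v₂)) (x : Amb d) ^ 4 +
      inner ℝ ((√2)⁻¹ • (v₁ - v₂)) (x : Amb d) ^ 4 = (1 / 2) * (inner ℝ v₁ (x : Amb d) ^ 4 +
      inner ℝ v₂ (x : Amb d) ^ 4) +
      3 * (inner ℝ v₁ (x : Amb d) ^ 2 * inner ℝ v₂ (x : Amb d) ^ 2) := fun x => by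
    simp only [inner_smul_left, inner_add_left, inner_sub_left, mul_pow, conj_trivial, hq]
    ring
  simp_rw [e6] at e5
  have hI3 : Integrable (fun x : Instance d => (1 / 2 : ℝ) * (inner ℝ v₁ (x : Amb d) ^ 4 +
      inner ℝ v₂ (x : Amb d) ^ 4)) ((uniformSphere d).restrict (band b w)) :=
    ((hI v₁).add (hI v₂)).const_mul _
  rw [integral_add hI3 (hI2.const_mul _), integral_const_mul,
    integral_const_mul, integral_add (hI _) (hI _), e3, e4] at e5
  linarith

/-- Squaring `∑ (eᵢ ⬝ x)² = 1 - (w ⬝ x)²` gives `d - 1` diagonal terms `M` and, for each, `d - 2`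
mixed terms `M / 3`; the factor is `(d - 1) (1 + (d - 2) / 3)`. -/
lemma mul_setIntegral_band_inner_pow_four {d : ℕ} (hd : 0 < d) (b : ℝ) {w v : Amb d}
    (hw : ‖w‖ = 1) (hv : ‖v‖ = 1) (hwv : inner ℝ w v = 0) :
    ((d : ℝ) - 1) * (d + 1) / 3 * ∫ x in band b w, inner ℝ v (x : Amb d) ^ 4 ∂uniformSphere d =
      ∫ x in band b w, (1 - inner ℝ w (x : Amb d) ^ 2) ^ 2 ∂uniformSphere d := by
  obtain ⟨e, he⟩ := exists_orthonormalBasis_apply_eq ⟨0, hd⟩ hw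
  set i₀ : Fin d := ⟨0, hd⟩
  set M := ∫ x in band b w, inner ℝ v (x : Amb d) ^ 4 ∂uniformSphere d with hM
  have h1 : ∀ x : Instance d, (1 - inner ℝ w (x : Amb d) ^ 2) ^ 2 =
      ∑ i ∈ Finset.univ.erase i₀, ∑ j ∈ Finset.univ.erase i₀,
        inner ℝ (e i) (x : Amb d) ^ 2 * inner ℝ (e j) (x : Amb d) ^ 2 := fun x => by
    rw [← Finset.sum_mul_sum, sum_erase_inner_sq, he, sq]
  simp_rw [h1]
  have hI : ∀ i j, Integrable (fun x : Instance d => inner ℝ (e i) (x : Amb d) ^ 2 *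
      inner ℝ (e j) (x : Amb d) ^ 2) ((uniformSphere d).restrict (band b w)) := fun i j =>
    integrable_inner_band hd b w (f := fun x => inner ℝ (e i) x ^ 2 * inner ℝ (e j) x ^ 2)
      (by fun_prop)
  rw [integral_finsetSum _ fun i _ => integrable_finsetSum _ fun j _ => hI i j]
  have hcard : ((Finset.univ.erase i₀).card : ℝ) = d - 1 := by
    rw [Finset.card_erase_of_mem (Finset.mem_univ _),
      Finset.card_univ, Fintype.card_fin, Nat.cast_sub hd, Nat.cast_one]
  have hperp : ∀ i ∈ Finset.univ.erase i₀, inner ℝ w (e i) = 0 := fun i hi => by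
    rw [← he]
    exact e.orthonormal.2 (Finset.ne_of_mem_erase hi).symm
  have h2 : ∀ i ∈ Finset.univ.erase i₀, ∫ x in band b w, ∑ j ∈ Finset.univ.erase i₀,
      inner ℝ (e i) (x : Amb d) ^ 2 * inner ℝ (e j) (x : Amb d) ^ 2 ∂uniformSphere d =
      M + (d - 2) * (M / 3) := fun i hi => by
    rw [integral_finsetSum _ fun j _ => hI i j, ← Finset.add_sum_erase _ _ hi]
    congr 1
    · rw [hM, ← setIntegral_band_inner_eq b (v := e i) (by simp [hv]) (hperp i hi) hwv
        (fun t => t ^ 4)]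
      refine integral_congr_ae (Filter.Eventually.of_forall fun x => ?_)
      simp only
      ring
    · rw [Finset.sum_congr rfl (g := fun _ => M / 3)]
      · rw [Finset.sum_const, nsmul_eq_mul, Finset.card_erase_of_mem hi, Nat.cast_sub, hcard]
        · push_cast; ring
        · exact Finset.card_pos.2 ⟨i, hi⟩
      · intro j hj
        refine setIntegral_band_inner_sq_mul_inner_sq hd b (by simp) (by simp) hv (hperp i hi)
          (hperp j (Finset.mem_of_mem_erase hj)) hwv ?_
        exact e.orthonormal.2 (Finset.ne_of_mem_erase hj).symm
  rw [Finset.sum_congr rfl h2, Finset.sum_const, nsmul_eq_mul, hcard]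
  ring

lemma setIntegral_band_inner {d : ℕ} (b : ℝ) {w v : Amb d} (hwv : inner ℝ w v = 0) :
    ∫ x in band b w, inner ℝ v (x : Amb d) ∂uniformSphere d = 0 := by
  have := setIntegral_band_inner_eq b (w := w) (v := v) (v' := -v) (by simp) hwv
    (by simp [hwv]) (fun t => t)
  simp only [inner_neg_left, integral_neg] at this
  linarith

/-- Conditionally on a thin band, the projection on an orthogonal direction has mean absolute
value at least `1 / (2 √(d - 1))`. -/
lemma le_setIntegral_band_abs_inner {d : ℕ} (hd : 2 ≤ d) {b : ℝ} (hb : 0 ≤ b) (hb' : b ≤ 1 / 10)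
    {w v : Amb d} (hw : ‖w‖ = 1) (hv : ‖v‖ = 1) (hwv : inner ℝ w v = 0) :
    (uniformSphere d).real (band b w) / (2 * √((d : ℝ) - 1)) ≤
      ∫ x in band b w, |inner ℝ v (x : Amb d)| ∂uniformSphere d := by
  have hd0 : 0 < d := by omega
  have := isProbabilityMeasure_uniformSphere hd0
  have hd1 : (1 : ℝ) ≤ d - 1 := by
    have : (2 : ℝ) ≤ d := by exact_mod_cast hd
    linarith
  set p := (uniformSphere d).real (band b w) with hp
  have hp0 : 0 ≤ p := measureReal_nonneg
  set n : ℝ := d - 1 with hn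
  set r := √n with hr
  have hr0 : 0 < r := Real.sqrt_pos.2 (by linarith)
  have hr2 : r ^ 2 = n := Real.sq_sqrt (by linarith)
  have h2 := mul_setIntegral_band_inner_sq hd0 b hw hv hwv
  have h4 := mul_setIntegral_band_inner_pow_four hd0 b hw hv hwv
  have hI : ∀ {f : Amb d → ℝ}, Continuous f → Integrable (fun x : Instance d => f x)
    ((uniformSphere d).restrict (band b w)) := integrable_inner_band hd0 b w
  have hs : ∀ x ∈ band b w, inner ℝ w (x : Amb d) ^ 2 ≤ 1 / 100 := fun x hx => by
    have := hx.1; have := hx.2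
    nlinarith
  have g2 : 99 / 100 * p ≤ ∫ x in band b w, (1 - inner ℝ w (x : Amb d) ^ 2) ∂uniformSphere d := by
    have : ∫ x in band b w, (99 / 100 : ℝ) ∂uniformSphere d = 99 / 100 * p := by
      rw [setIntegral_const, smul_eq_mul, mul_comm]
    rw [← this]
    refine setIntegral_mono_on (integrable_const _) (hI (f := fun x => 1 - inner ℝ w x ^ 2)
      (by fun_prop)) (measurableSet_band b w) fun x hx => ?_
    have := hs x hx
    linarith
  have g4 : ∫ x in band b w, (1 - inner ℝ w (x : Amb d) ^ 2) ^ 2 ∂uniformSphere d ≤ p := by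
    have : ∫ x in band b w, (1 : ℝ) ∂uniformSphere d = p := by
      rw [setIntegral_const, smul_eq_mul, mul_one]
    rw [← this]
    refine setIntegral_mono_on (hI (f := fun x => (1 - inner ℝ w x ^ 2) ^ 2)
      (by fun_prop)) (integrable_const _) (measurableSet_band b w) fun x hx => ?_
    have := hs x hx
    have := sq_nonneg (inner ℝ w (x : Amb d))
    nlinarith
  set M2 := ∫ x in band b w, inner ℝ v (x : Amb d) ^ 2 ∂uniformSphere d with hM2
  set M4 := ∫ x in band b w, inner ℝ v (x : Amb d) ^ 4 ∂uniformSphere d with hM4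
  have hM40 : 0 ≤ M4 := integral_nonneg fun x => by positivity
  have k2 : 99 / 100 * p ≤ n * M2 := h2 ▸ g2
  have k4 : n ^ 2 * M4 ≤ 3 * p := by
    have : (d : ℝ) + 1 = n + 2 := by rw [hn]; ring
    rw [this] at h4
    nlinarith [mul_nonneg (by linarith : (0 : ℝ) ≤ n) hM40]
  -- This even quartic touches `|t|` at `|t| = 2 / r`, whence the square factor below. Integrated,
  -- it bounds the first absolute moment from below by the second and fourth moments.
  have hpt : ∀ t : ℝ, 3 / 4 * r * t ^ 2 - r ^ 3 / 16 * t ^ 4 ≤ |t| := by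
    intro t
    have ht := abs_nonneg t
    rw [← sq_abs t, show t ^ 4 = |t| ^ 4 by rw [show 4 = 2 * 2 from rfl, pow_mul, pow_mul, sq_abs]]
    set y := |t|
    have : 0 ≤ y * (r * y / 2 - 1) ^ 2 * (r * y / 2 + 2) := by positivity
    nlinarith
  have hint : 3 / 4 * r * M2 - r ^ 3 / 16 * M4 ≤
      ∫ x in band b w, |inner ℝ v (x : Amb d)| ∂uniformSphere d := by
    rw [hM2, hM4, ← integral_const_mul, ← integral_const_mul, ← integral_sub
      (hI (f := fun x => 3 / 4 * r * inner ℝ v x ^ 2) (by fun_prop))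
      (hI (f := fun x => r ^ 3 / 16 * inner ℝ v x ^ 4) (by fun_prop))]
    exact integral_mono
      (hI (f := fun x => 3 / 4 * r * inner ℝ v x ^ 2 - r ^ 3 / 16 * inner ℝ v x ^ 4) (by fun_prop))
      (hI (f := fun x => |inner ℝ v x|) (by fun_prop)) fun x => hpt _
  refine le_trans ?_ hint
  rw [div_le_iff₀ (by positivity)]
  have e1 : (3 / 4 * r * M2 - r ^ 3 / 16 * M4) * (2 * r) =
      3 / 2 * (r ^ 2 * M2) - 1 / 8 * ((r ^ 2) ^ 2 * M4) := by ring
  rw [e1, hr2]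
  linarith

lemma setIntegral_band_inner_sq_le {d : ℕ} (hd : 2 ≤ d) (b : ℝ)
    {w v : Amb d} (hw : ‖w‖ = 1) (hv : ‖v‖ = 1) (hwv : inner ℝ w v = 0) :
    ∫ x in band b w, inner ℝ v (x : Amb d) ^ 2 ∂uniformSphere d ≤
      (uniformSphere d).real (band b w) / ((d : ℝ) - 1) := by
  have hd0 : 0 < d := by omega
  have := isProbabilityMeasure_uniformSphere hd0
  have hd1 : (1 : ℝ) ≤ d - 1 := by
    have : (2 : ℝ) ≤ d := by exact_mod_cast hd
    linarith
  rw [le_div_iff₀ (by linarith), mul_comm, mul_setIntegral_band_inner_sq hd0 b hw hv hwv]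
  have : ∫ x in band b w, (1 : ℝ) ∂uniformSphere d = (uniformSphere d).real (band b w) := by
    rw [setIntegral_const, smul_eq_mul, mul_one]
  rw [← this]
  refine integral_mono (integrable_inner_band hd0 b w (f := fun x => 1 - inner ℝ w x ^ 2)
    (by fun_prop)) (integrable_const _) fun x => ?_
  have := sq_nonneg (inner ℝ w (x : Amb d))
  simpa using this

/-! ### Lower bound for the probability of a thin band. -/

/-- Log-convexity of `Gamma` at the midpoint of `x` and `x + 1`. It controls the ratio of the
volumes of unit balls in consecutive dimensions. -/
lemma Gamma_add_half_le {x : ℝ} (hx : 0 < x) :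
    √x * Real.Gamma (x + 1 / 2) ≤ Real.Gamma (x + 1) := by
  have h := Real.Gamma_mul_add_mul_le_rpow_Gamma_mul_rpow_Gamma hx (by linarith : 0 < x + 1)
    (by norm_num : (0 : ℝ) < 1 / 2) (by norm_num : (0 : ℝ) < 1 / 2) (by norm_num)
  rw [← Real.sqrt_eq_rpow, ← Real.sqrt_eq_rpow,
    show 1 / 2 * x + 1 / 2 * (x + 1) = x + 1 / 2 by ring] at h
  have h1 : Real.Gamma (x + 1) = x * Real.Gamma x := Real.Gamma_add_one hx.ne'
  have h0 := Real.Gamma_pos_of_pos hx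
  refine (mul_le_mul_of_nonneg_left h (Real.sqrt_nonneg x)).trans (le_of_eq ?_)
  rw [← Real.sqrt_mul h0.le, ← Real.sqrt_mul hx.le,
    show x * (Real.Gamma x * Real.Gamma (x + 1)) = Real.Gamma (x + 1) ^ 2 by rw [h1]; ring,
    Real.sqrt_sq]
  rw [h1]; positivity

/-- Volume of the unit ball of dimension `n`. -/
def ballVolume (n : ℕ) : ℝ := √Real.pi ^ n / Real.Gamma (n / 2 + 1)

lemma ballVolume_pos (n : ℕ) : 0 < ballVolume n := by
  have := Real.Gamma_pos_of_pos (by positivity : (0 : ℝ) < n / 2 + 1)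
  have := Real.pi_pos
  unfold ballVolume
  positivity

lemma sqrt_mul_ballVolume_succ_le (n : ℕ) :
    √((n + 1 : ℕ) : ℝ) * ballVolume (n + 1) ≤ 3 * ballVolume n := by
  have h := Gamma_add_half_le (by positivity : (0 : ℝ) < ((n + 1 : ℕ) : ℝ) / 2)
  have e : ((n + 1 : ℕ) : ℝ) / 2 + 1 / 2 = n / 2 + 1 := by push_cast; ring
  rw [e, Real.sqrt_div (by positivity)] at h
  unfold ballVolume
  have g1 := Real.Gamma_pos_of_pos (by positivity : (0 : ℝ) < n / 2 + 1)
  have g2 := Real.Gamma_pos_of_pos (by positivity : (0 : ℝ) < ((n + 1 : ℕ) : ℝ) / 2 + 1)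
  have hs : √Real.pi * √2 ≤ 3 := by
    rw [← Real.sqrt_mul Real.pi_pos.le]
    refine Real.sqrt_le_iff.2 ⟨by norm_num, ?_⟩
    have := Real.pi_lt_d2
    linarith
  have hp : 0 < √Real.pi ^ n := pow_pos (Real.sqrt_pos.2 Real.pi_pos) n
  rw [mul_div_assoc', mul_div_assoc', div_le_div_iff₀ g2 g1, pow_succ]
  have h2 : √((n + 1 : ℕ) : ℝ) * Real.Gamma (n / 2 + 1) ≤
      √2 * Real.Gamma (((n + 1 : ℕ) : ℝ) / 2 + 1) := by
    rw [div_mul_eq_mul_div, div_le_iff₀ (by positivity)] at h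
    linarith
  have h3 := mul_le_mul_of_nonneg_left h2 (Real.sqrt_nonneg Real.pi)
  have h4 := mul_le_mul_of_nonneg_right hs g2.le
  rw [mul_assoc] at h4
  have h5 := mul_le_mul_of_nonneg_left (h3.trans h4) hp.le
  linarith [h5]

lemma volume_annulus (n : ℕ) [NeZero n] {r R : ℝ} (hr : 0 ≤ r) (hrR : r ≤ R) :
    (volume : Measure (Amb n)) (Metric.ball 0 R \ Metric.ball 0 r) =
      ENNReal.ofReal ((R ^ n - r ^ n) * ballVolume n) := by
  have := ballVolume_pos n
  rw [measure_sdiff (Metric.ball_subset_ball hrR) measurableSet_ball.nullMeasurableSet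
    measure_ball_lt_top.ne, EuclideanSpace.volume_ball, EuclideanSpace.volume_ball,
    Fintype.card_fin,
    ← ENNReal.ofReal_pow hr, ← ENNReal.ofReal_pow (hr.trans hrR)]
  have hRn : 0 ≤ R ^ n := pow_nonneg (hr.trans hrR) n
  rw [← ballVolume, ← ENNReal.ofReal_mul hRn, ← ENNReal.ofReal_mul (pow_nonneg hr n),
    ← ENNReal.ofReal_sub _ (by positivity), sub_mul]

/-- Splitting off the first coordinate. -/
def splitFirst (n : ℕ) (y : Amb (n + 1)) : ℝ × Amb n :=
  (y 0, WithLp.toLp 2 fun i => y i.succ)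

lemma measurePreserving_splitFirst (n : ℕ) : MeasurePreserving (splitFirst n) := by
  have h1 := PiLp.volume_preserving_ofLp (Fin (n + 1))
  have h2 := volume_preserving_piFinSuccAbove (fun _ : Fin (n + 1) => ℝ) 0
  have h3 := (MeasurePreserving.id (volume : Measure ℝ)).prod (PiLp.volume_preserving_toLp (Fin n))
  exact (h3.comp h2).comp h1

lemma norm_sq_splitFirst {n : ℕ} (y : Amb (n + 1)) :
    ‖y‖ ^ 2 = (splitFirst n y).1 ^ 2 + ‖(splitFirst n y).2‖ ^ 2 := by
  rw [EuclideanSpace.norm_sq_eq, EuclideanSpace.norm_sq_eq, Fin.sum_univ_succ]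
  simp [splitFirst]

open scoped Pointwise in
/-- A thin band has probability at least of the order of `b √d`. -/
theorem le_uniformSphere_band {d : ℕ} (hd : 3 ≤ d) {b : ℝ} (hb : 0 < b)
    (hb' : d * b ^ 2 ≤ 1 / 100) {w : Amb d} (hw : ‖w‖ = 1) :
    b * √(d : ℝ) / 30 ≤ (uniformSphere d).real (band b w) := by
  obtain ⟨n, rfl⟩ : ∃ n, d = n + 1 := ⟨d - 1, by omega⟩
  have hn : 2 ≤ n := by omega
  have : NeZero n := ⟨by omega⟩
  set w₀ : Amb (n + 1) := EuclideanSpace.single 0 1 with hw₀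
  rw [measureReal_def, uniformSphere_band_eq b (w' := w₀) (by simp [hw, hw₀]), ← measureReal_def]
  have hb1 : b ≤ 1 / 10 := by
    have : (1 : ℝ) ≤ ((n + 1 : ℕ) : ℝ) := by push_cast; linarith [(Nat.cast_nonneg n : (0 : ℝ) ≤ n)]
    nlinarith [sq_nonneg b]
  set R := √(1 - b ^ 2) with hR
  have hR2 : R ^ 2 = 1 - b ^ 2 := Real.sq_sqrt (by nlinarith)
  have hR0 : 0 ≤ R := Real.sqrt_nonneg _
  have hR3 : 3 / 4 ≤ R := Real.le_sqrt_of_sq_le (by nlinarith)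
  have hRb : 1 - b ^ 2 ≤ R := by
    refine Real.le_sqrt_of_sq_le ?_
    nlinarith [sq_nonneg b]
  have hRn : 99 / 100 ≤ R ^ n := by
    have h1 : 1 + n * (-b ^ 2) ≤ (1 + (-b ^ 2)) ^ n :=
      one_add_mul_le_pow (by nlinarith) n
    have h2 : (1 + (-b ^ 2)) ^ n ≤ R ^ n := pow_le_pow_left₀ (by nlinarith) (by linarith) n
    push_cast at hb'
    nlinarith [sq_nonneg b]
  have h34 : (3 / 4 : ℝ) ^ n ≤ 9 / 16 := by
    refine (pow_le_pow_of_le_one (by norm_num) (by norm_num) hn).trans (by norm_num)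
  -- A product set inside the cone over the band. Its points have norm in `[3 / 4, 1)`, the choice
  -- of `R` giving the upper limit, so a first coordinate in `[b / 2, 3 b / 4]` is normalized into
  -- `[b / 2, b]`.
  set A : Set (Amb (n + 1)) := splitFirst n ⁻¹' (Set.Icc (b / 2) (3 * b / 4) ×ˢ
    (Metric.ball 0 R \ Metric.ball 0 (3 / 4))) with hA
  have hAv : volume A = ENNReal.ofReal (b / 4 * ((R ^ n - (3 / 4) ^ n) * ballVolume n)) := by
    rw [hA, (measurePreserving_splitFirst n).measure_preimage
      (measurableSet_Icc.prod (measurableSet_ball.diff measurableSet_ball)).nullMeasurableSet,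
      Measure.volume_eq_prod, Measure.prod_prod, Real.volume_Icc,
      volume_annulus n (by norm_num) hR3, ← ENNReal.ofReal_mul (by linarith)]
    congr 2; ring
  have hsub : A ⊆ Set.Ioo (0 : ℝ) 1 • ((↑) '' band b w₀) := by
    intro y hy
    obtain ⟨⟨h1, h2⟩, h3, h4⟩ := hy
    have hN := norm_sq_splitFirst y
    rw [mem_ball_zero_iff] at h3 h4
    rw [not_lt] at h4
    have h5 : ‖(splitFirst n y).2‖ ^ 2 < R ^ 2 := pow_lt_pow_left₀ h3 (norm_nonneg _) (by norm_num)
    have h6 : (3 / 4) ^ 2 ≤ ‖(splitFirst n y).2‖ ^ 2 := pow_le_pow_left₀ (by norm_num) h4 2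
    have hy1 : ‖y‖ < 1 := by
      rw [← sq_lt_one_iff₀ (norm_nonneg _)]
      nlinarith
    have hy2 : 3 / 4 ≤ ‖y‖ := by
      refine (sq_le_sq₀ (by norm_num) (norm_nonneg _)).1 ?_
      nlinarith [sq_nonneg (splitFirst n y).1]
    have hy0 : 0 < ‖y‖ := by linarith
    refine ⟨‖y‖, ⟨hy0, hy1⟩, ‖y‖⁻¹ • y, ⟨⟨‖y‖⁻¹ • y, ?_⟩, ?_, rfl⟩, ?_⟩
    · rw [mem_sphere_zero_iff_norm, norm_smul, norm_inv, norm_norm, inv_mul_cancel₀ hy0.ne']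
    · have : inner ℝ w₀ (‖y‖⁻¹ • y) = (splitFirst n y).1 / ‖y‖ := by
        rw [inner_smul_right, hw₀, EuclideanSpace.inner_single_left]
        simp [splitFirst]; ring
      change b / 2 ≤ inner ℝ w₀ (‖y‖⁻¹ • y) ∧ inner ℝ w₀ (‖y‖⁻¹ • y) ≤ b
      rw [this, le_div_iff₀ hy0, div_le_iff₀ hy0]
      constructor <;> nlinarith
    · change ‖y‖ • (‖y‖⁻¹ • y) = y
      rw [smul_inv_smul₀ hy0.ne']
  have hball : (volume : Measure (Amb (n + 1))) (Metric.ball 0 1) =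
      ENNReal.ofReal (ballVolume (n + 1)) := by
    rw [EuclideanSpace.volume_ball, Fintype.card_fin, ENNReal.ofReal_one, one_pow, one_mul,
      ballVolume]
  have hmain : ENNReal.ofReal (b / 4 * ((R ^ n - (3 / 4) ^ n) * ballVolume n) /
      ballVolume (n + 1)) ≤ uniformSphere (n + 1) (band b w₀) := by
    rw [uniformSphere, Measure.smul_apply, smul_eq_mul, Measure.toSphere_apply_univ,
      Measure.toSphere_apply' _ (measurableSet_band b w₀), hball, finrank_euclideanSpace_fin,
      ENNReal.ofReal_div_of_pos (ballVolume_pos _), ← hAv, ENNReal.div_eq_inv_mul,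
      ENNReal.mul_inv (Or.inr ENNReal.ofReal_ne_top) (Or.inl (ENNReal.natCast_ne_top _)),
      mul_mul_mul_comm, ENNReal.inv_mul_cancel (by simp)
      (ENNReal.natCast_ne_top _), one_mul]
    exact mul_le_mul_right (measure_mono hsub) _
  have hP := isProbabilityMeasure_uniformSphere (d := n + 1) (by omega)
  rw [ENNReal.ofReal_le_iff_le_toReal (measure_ne_top _ _)] at hmain
  refine le_trans ?_ hmain
  rw [le_div_iff₀ (ballVolume_pos _)]
  have h7 := sqrt_mul_ballVolume_succ_le n
  have h8 := ballVolume_pos n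
  -- The constant 30 arises here: `1 / 4` from the width of the slab, `2 / 5` from the annulus and
  -- `1 / 3` from the ratio of the ball volumes.
  have h9 : 2 / 5 * ballVolume n ≤ (R ^ n - (3 / 4) ^ n) * ballVolume n := by
    apply mul_le_mul_of_nonneg_right _ h8.le
    linarith
  have h10 := mul_le_mul_of_nonneg_left h7 hb.le
  have h11 := mul_le_mul_of_nonneg_left h9 hb.le
  nlinarith

/-! ### The update and the pointwise change of the gap. -/

open Classical in
/-- The update of the modified Perceptron at the vector `w` with the labelled example `z`. -/
def update {d : ℕ} (w : Amb d) (z : Example d) : Amb d :=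
  if Label.val z.2 * inner ℝ w (z.1 : Amb d) < 0 then
    w - (2 * inner ℝ w (z.1 : Amb d)) • (z.1 : Amb d)
  else w

/-- The potential `1 - w ⬝ u`. -/
def gap {d : ℕ} (u w : Amb d) : ℝ := 1 - inner ℝ w u

/-- The examples whose instance lies in the band around `w`. -/
def labelledBand {d : ℕ} (b : ℝ) (w : Amb d) : Set (Example d) := Prod.fst ⁻¹' band b w

/-- The examples whose label disagrees with the halfspace classifier of `u`. -/
def noiseSet {d : ℕ} (u : Instance d) : Set (Example d) := {z | z.2 ≠ halfspace u z.1}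

lemma Label.val_true : Label.val true = 1 := rfl

lemma Label.val_false : Label.val false = -1 := rfl

lemma measurable_label_val : Measurable Label.val := measurable_of_countable _

lemma measurable_update {d : ℕ} : Measurable fun q : Amb d × Example d => update q.1 q.2 := by
  have h1 : Measurable fun q : Amb d × Example d => (q.2.1 : Amb d) :=
    measurable_subtype_coe.comp (measurable_fst.comp measurable_snd)
  have h2 : Measurable fun q : Amb d × Example d => inner ℝ q.1 (q.2.1 : Amb d) :=
    measurable_fst.inner h1
  have h3 : Measurable fun q : Amb d × Example d => Label.val q.2.2 :=
    measurable_label_val.comp (measurable_snd.comp measurable_snd)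
  refine Measurable.ite (measurableSet_lt (h3.mul h2) measurable_const) ?_ measurable_fst
  exact measurable_fst.sub ((h2.const_mul 2).smul h1)

lemma measurableSet_labelledBand_prod {d : ℕ} (b : ℝ) :
    MeasurableSet {q : Amb d × Example d | q.2 ∈ labelledBand b q.1} := by
  have h1 : Measurable fun q : Amb d × Example d => (q.2.1 : Amb d) :=
    measurable_subtype_coe.comp (measurable_fst.comp measurable_snd)
  have h2 : Measurable fun q : Amb d × Example d => inner ℝ q.1 (q.2.1 : Amb d) :=
    measurable_fst.inner h1
  exact (measurableSet_le measurable_const h2).inter (measurableSet_le h2 measurable_const)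

lemma measurableSet_labelledBand {d : ℕ} (b : ℝ) (w : Amb d) :
    MeasurableSet (labelledBand b w) := measurable_fst (measurableSet_band b w)

lemma measurable_gap {d : ℕ} (u : Amb d) : Measurable (gap u) := by
  unfold gap; fun_prop

lemma norm_update {d : ℕ} (w : Amb d) (z : Example d) : ‖update w z‖ = ‖w‖ := by
  unfold update
  split_ifs
  · have hx : ‖(z.1 : Amb d)‖ = 1 := by simp
    rw [← sq_eq_sq₀ (norm_nonneg _) (norm_nonneg _), norm_sub_sq_real, norm_smul, inner_smul_right,
      mul_pow, hx, Real.norm_eq_abs, sq_abs]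
    ring
  · rfl

lemma measurable_halfspace {d : ℕ} (u : Instance d) : Measurable (halfspace u) := by
  refine measurable_to_bool ?_
  have : halfspace u ⁻¹' {true} = {x : Instance d | 0 ≤ inner ℝ (u : Amb d) (x : Amb d)} := by
    ext x; simp [halfspace]
  rw [this]
  exact measurableSet_le measurable_const
    (g := fun x : Instance d => inner ℝ (u : Amb d) (x : Amb d)) (by fun_prop)

lemma measurableSet_noiseSet {d : ℕ} (u : Instance d) : MeasurableSet (noiseSet u) :=
  (measurableSet_eq_fun measurable_snd ((measurable_halfspace u).comp measurable_fst)).compl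

/-- An update changes the gap by `2 (w ⬝ x) (u ⬝ x)`. A clean mistake has `u ⬝ x < 0` and gains by
`2 (w ⬝ x) ≥ b`, the lower edge of the band; `(t - |t|) / 2` is `min t 0`. The noise term covers
both a harmful update, by `w ⬝ x ≤ b`, and a missed useful one. -/
lemma gap_update_sub_le {d : ℕ} {b : ℝ} (hb : 0 < b) (u : Instance d) (w : Amb d) {z : Example d}
    (hz : z ∈ labelledBand b w) :
    gap u (update w z) - gap u w ≤
      b * ((inner ℝ (u : Amb d) (z.1 : Amb d) - |inner ℝ (u : Amb d) (z.1 : Amb d)|) / 2) +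
        2 * b * (noiseSet u).indicator 1 z * |inner ℝ (u : Amb d) (z.1 : Amb d)| := by
  obtain ⟨h1, h2⟩ := hz
  obtain ⟨x, y⟩ := z
  simp only [gap, update, noiseSet] at *
  have e : inner ℝ (x : Amb d) (u : Amb d) = inner ℝ (u : Amb d) (x : Amb d) := real_inner_comm _ _
  set s := inner ℝ w (x : Amb d)
  set t := inner ℝ (u : Amb d) (x : Amb d) with ht
  have hs : 0 < s := by linarith
  cases y
  · rw [if_pos (by rw [Label.val_false]; linarith), inner_sub_left, inner_smul_left, conj_trivial,
      e]
    by_cases h0 : 0 ≤ t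
    · rw [Set.indicator_of_mem (by simp [halfspace, ← ht, h0]), abs_of_nonneg h0, Pi.one_apply]
      nlinarith
    · rw [Set.indicator_of_notMem (by simpa [halfspace, ← ht] using h0)]
      rw [not_le] at h0
      rw [abs_of_neg h0]
      nlinarith
  · rw [if_neg (by rw [Label.val_true]; linarith)]
    by_cases h0 : 0 ≤ t
    · rw [Set.indicator_of_notMem (by simp [halfspace, ← ht, h0]), abs_of_nonneg h0]
      linarith
    · rw [Set.indicator_of_mem (by simpa [halfspace, ← ht] using h0), Pi.one_apply]
      rw [not_le] at h0
      rw [abs_of_neg h0]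
      nlinarith

lemma abs_gap_update_sub_le {d : ℕ} {b : ℝ} (hb : 0 < b) (u : Instance d) (w : Amb d)
    {z : Example d} (hz : z ∈ labelledBand b w) :
    |gap u (update w z) - gap u w| ≤ 2 * b * |inner ℝ (u : Amb d) (z.1 : Amb d)| := by
  obtain ⟨h1, h2⟩ := hz
  simp only [gap, update]
  have e : inner ℝ (z.1 : Amb d) (u : Amb d) = inner ℝ (u : Amb d) (z.1 : Amb d) :=
    real_inner_comm _ _
  split_ifs
  · rw [inner_sub_left, inner_smul_left, conj_trivial, e]
    rw [show ∀ p q r : ℝ, 1 - (p - 2 * q * r) - (1 - p) = 2 * q * r by intros; ring, abs_mul]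
    refine mul_le_mul_of_nonneg_right ?_ (abs_nonneg _)
    rw [abs_of_nonneg (by linarith)]
    linarith
  · rw [sub_self, abs_zero]
    positivity

lemma setIntegral_labelledBand {d : ℕ} {D : Measure (Example d)}
    (hD : D.map Prod.fst = uniformSphere d) (b : ℝ) (w : Amb d) {f : Amb d → ℝ}
    (hf : Continuous f) :
    ∫ z in labelledBand b w, f (z.1 : Amb d) ∂D = ∫ x in band b w, f x ∂uniformSphere d := by
  rw [← hD, setIntegral_map (measurableSet_band b w) _ measurable_fst.aemeasurable]
  · rfl
  · exact (hf.comp continuous_subtype_val).aestronglyMeasurable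

lemma measure_labelledBand {d : ℕ} {D : Measure (Example d)}
    (hD : D.map Prod.fst = uniformSphere d) (b : ℝ) (w : Amb d) :
    D (labelledBand b w) = uniformSphere d (band b w) := by
  rw [← hD, Measure.map_apply measurable_fst (measurableSet_band b w)]; rfl

lemma exists_orthogonal_decomposition {d : ℕ} {u w : Amb d} (hu : ‖u‖ = 1) (hw : ‖w‖ = 1) {a : ℝ}
    (ha : 0 < a) (ha2 : a ^ 2 = 1 - inner ℝ w u ^ 2) :
    ∃ v : Amb d, ‖v‖ = 1 ∧ inner ℝ w v = 0 ∧ u = (inner ℝ w u : ℝ) • w + a • v := by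
  refine ⟨a⁻¹ • (u - (inner ℝ w u : ℝ) • w), ?_, ?_, ?_⟩
  · rw [norm_smul, Real.norm_eq_abs, abs_of_pos (inv_pos.2 ha), inv_mul_eq_one₀ ha.ne',
      ← sq_eq_sq₀ ha.le (norm_nonneg _), norm_sub_sq_real, norm_smul, inner_smul_right, hu, mul_pow,
      hw, Real.norm_eq_abs, sq_abs, real_inner_comm w u, ha2]
    ring
  · rw [inner_smul_right, inner_sub_right, inner_smul_right, real_inner_self_eq_norm_sq, hw]
    ring
  · rw [smul_inv_smul₀ ha.ne']
    abel

/-! ### Mean, second moment and exponential moment of the change of the gap. -/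

section Drift

variable {d : ℕ} {D : Measure (Example d)} {u : Instance d} {w : Amb d} {a b ν p : ℝ}

/-- With `u ⬝ x = c s + a t` and `c s ≤ b`, one has `min (u ⬝ x) 0 ≤ b + a min t 0`. Since `t` has
mean zero, the mean of `min t 0` is minus half the mean of `|t|`. -/
lemma setIntegral_labelledBand_inner_sub_abs_le (hd : 2 ≤ d) (hD : D.map Prod.fst = uniformSphere d)
    (hw : ‖w‖ = 1) (ha : 0 < a) (ha2 : a ^ 2 = 1 - inner ℝ w (u : Amb d) ^ 2) (hb : 0 < b)
    (hb' : b ≤ 1 / 10) (hp : p = (uniformSphere d).real (band b w)) :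
    ∫ z in labelledBand b w, (inner ℝ (u : Amb d) (z.1 : Amb d) -
      |inner ℝ (u : Amb d) (z.1 : Amb d)|) / 2 ∂D ≤ (b - a / (4 * √((d : ℝ) - 1))) * p := by
  have hd0 : 0 < d := by omega
  have hP := isProbabilityMeasure_uniformSphere hd0
  have hu : ‖(u : Amb d)‖ = 1 := by simp
  obtain ⟨v, hv, hwv, huv⟩ := exists_orthogonal_decomposition hu hw ha ha2
  have hc : |inner ℝ w (u : Amb d)| ≤ 1 := by
    rw [← sq_le_one_iff_abs_le_one]; nlinarith
  set c : ℝ := inner ℝ w (u : Amb d)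
  have hI : ∀ {f : Amb d → ℝ}, Continuous f → Integrable (fun x : Instance d => f x)
    ((uniformSphere d).restrict (band b w)) := integrable_inner_band hd0 b w
  rw [setIntegral_labelledBand hD b w
    (f := fun x => (inner ℝ (u : Amb d) x - |inner ℝ (u : Amb d) x|) / 2) (by fun_prop)]
  have h1 : ∫ x in band b w, (inner ℝ (u : Amb d) (x : Amb d) -
      |inner ℝ (u : Amb d) (x : Amb d)|) / 2 ∂uniformSphere d ≤
      ∫ x in band b w, (b + a / 2 * (inner ℝ v (x : Amb d) - |inner ℝ v (x : Amb d)|))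
        ∂uniformSphere d := by
    refine setIntegral_mono_on
      (hI (f := fun x => (inner ℝ (u : Amb d) x - |inner ℝ (u : Amb d) x|) / 2) (by fun_prop))
      (hI (f := fun x => b + a / 2 * (inner ℝ v x - |inner ℝ v x|)) (by fun_prop))
      (measurableSet_band b w) fun x hx => ?_
    obtain ⟨hx1, hx2⟩ := hx
    have e : inner ℝ (u : Amb d) (x : Amb d) =
        c * inner ℝ w (x : Amb d) + a * inner ℝ v (x : Amb d) := by
      conv_lhs => rw [huv]
      rw [inner_add_left, inner_smul_left, inner_smul_left, conj_trivial, conj_trivial]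
    rw [e]
    set s := inner ℝ w (x : Amb d)
    set t := inner ℝ v (x : Amb d)
    have hcs : c * s ≤ b := by
      have := (abs_le.1 hc).2
      nlinarith
    have k1 := neg_abs_le (c * s + a * t)
    have k2 := le_abs_self (c * s + a * t)
    rcases abs_cases t with h | h <;> rcases abs_cases (c * s + a * t) with h' | h' <;>
      nlinarith [abs_nonneg t]
  refine h1.trans ?_
  have i1 : Integrable (fun x : Instance d => a / 2 * (inner ℝ v (x : Amb d) -
      |inner ℝ v (x : Amb d)|)) ((uniformSphere d).restrict (band b w)) :=
    hI (f := fun x => a / 2 * (inner ℝ v x - |inner ℝ v x|)) (by fun_prop)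
  rw [integral_add (integrable_const _) i1, integral_const_mul,
    integral_sub (hI (f := fun x => inner ℝ v x) (by fun_prop))
      (hI (f := fun x => |inner ℝ v x|) (by fun_prop)), setIntegral_band_inner b hwv,
    setIntegral_const, smul_eq_mul, ← hp]
  have h2 := le_setIntegral_band_abs_inner hd hb.le hb' hw hv hwv
  rw [← hp] at h2
  have h3 := mul_le_mul_of_nonneg_left h2 ha.le
  have h4 : a * (p / (2 * √((d : ℝ) - 1))) = 2 * (a / (4 * √((d : ℝ) - 1)) * p) := by ring
  linarith

lemma setIntegral_labelledBand_inner_sq_le (hd : 2 ≤ d) (hD : D.map Prod.fst = uniformSphere d)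
    (hw : ‖w‖ = 1) (ha : 0 < a) (ha2 : a ^ 2 = 1 - inner ℝ w (u : Amb d) ^ 2) (hb : 0 < b)
    (hp : p = (uniformSphere d).real (band b w)) :
    ∫ z in labelledBand b w, inner ℝ (u : Amb d) (z.1 : Amb d) ^ 2 ∂D ≤
      2 * (b ^ 2 + a ^ 2 / ((d : ℝ) - 1)) * p := by
  have hd0 : 0 < d := by omega
  have hP := isProbabilityMeasure_uniformSphere hd0
  have hu : ‖(u : Amb d)‖ = 1 := by simp
  obtain ⟨v, hv, hwv, huv⟩ := exists_orthogonal_decomposition hu hw ha ha2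
  have hc : |inner ℝ w (u : Amb d)| ≤ 1 := by
    rw [← sq_le_one_iff_abs_le_one]; nlinarith
  set c : ℝ := inner ℝ w (u : Amb d)
  have hI : ∀ {f : Amb d → ℝ}, Continuous f → Integrable (fun x : Instance d => f x)
    ((uniformSphere d).restrict (band b w)) := integrable_inner_band hd0 b w
  rw [setIntegral_labelledBand hD b w (f := fun x => inner ℝ (u : Amb d) x ^ 2) (by fun_prop)]
  have h1 : ∫ x in band b w, inner ℝ (u : Amb d) (x : Amb d) ^ 2 ∂uniformSphere d ≤
      ∫ x in band b w, (2 * b ^ 2 + 2 * a ^ 2 * inner ℝ v (x : Amb d) ^ 2) ∂uniformSphere d := by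
    refine setIntegral_mono_on (hI (f := fun x => inner ℝ (u : Amb d) x ^ 2) (by fun_prop))
      (hI (f := fun x => 2 * b ^ 2 + 2 * a ^ 2 * inner ℝ v x ^ 2) (by fun_prop))
      (measurableSet_band b w) fun x hx => ?_
    obtain ⟨hx1, hx2⟩ := hx
    have e : inner ℝ (u : Amb d) (x : Amb d) =
        c * inner ℝ w (x : Amb d) + a * inner ℝ v (x : Amb d) := by
      conv_lhs => rw [huv]
      rw [inner_add_left, inner_smul_left, inner_smul_left, conj_trivial, conj_trivial]
    rw [e]
    set s := inner ℝ w (x : Amb d)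
    set t := inner ℝ v (x : Amb d)
    have hc2 : c ^ 2 ≤ 1 := by nlinarith
    have hs2 : s ^ 2 ≤ b ^ 2 := by nlinarith
    have hcs : (c * s) ^ 2 ≤ b ^ 2 := by
      rw [mul_pow]
      nlinarith [sq_nonneg s]
    nlinarith [sq_nonneg (c * s - a * t)]
  refine h1.trans ?_
  rw [integral_add (integrable_const _)
    (hI (f := fun x => 2 * a ^ 2 * inner ℝ v x ^ 2) (by fun_prop)), setIntegral_const,
    integral_const_mul, smul_eq_mul, ← hp]
  have h2 := setIntegral_band_inner_sq_le hd b hw hv hwv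
  rw [← hp] at h2
  have h3 := mul_le_mul_of_nonneg_left h2 (by positivity : 0 ≤ 2 * a ^ 2)
  have h4 : 2 * a ^ 2 * (p / ((d : ℝ) - 1)) = 2 * (a ^ 2 / ((d : ℝ) - 1) * p) := by ring
  linarith

lemma integrable_labelledBand_inner [IsFiniteMeasure D] {f : ℝ → ℝ} (hf : Continuous f) :
    Integrable (fun z : Example d => f (inner ℝ (u : Amb d) (z.1 : Amb d)))
      (D.restrict (labelledBand b w)) := by
  have hc : Continuous fun x : Instance d => f (inner ℝ (u : Amb d) (x : Amb d)) := by fun_prop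
  obtain ⟨M, hM⟩ := (isCompact_univ (X := Instance d)).exists_bound_of_continuousOn hc.continuousOn
  refine Integrable.of_bound ((hc.measurable.comp measurable_fst).aestronglyMeasurable) M
    (Filter.Eventually.of_forall fun z => hM z.1 (Set.mem_univ _))

lemma measurable_gap_update_sub :
    Measurable fun z : Example d => gap u (update w z) - gap (u : Amb d) w :=
  ((measurable_gap _).comp (measurable_update.comp (measurable_const.prodMk measurable_id))).sub
    measurable_const

lemma abs_inner_le_one (u x : Instance d) : |inner ℝ (u : Amb d) (x : Amb d)| ≤ 1 := by
  have := abs_real_inner_le_norm (u : Amb d) (x : Amb d)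
  simpa using this

lemma integrable_gap_update_sub [IsFiniteMeasure D] (hb : 0 < b) :
    Integrable (fun z : Example d => gap u (update w z) - gap (u : Amb d) w)
      (D.restrict (labelledBand b w)) := by
  refine Integrable.of_bound measurable_gap_update_sub.aestronglyMeasurable (2 * b) ?_
  filter_upwards [ae_restrict_mem (measurableSet_labelledBand b w)] with z hz
  have := abs_gap_update_sub_le hb u w hz
  have := abs_inner_le_one u z.1
  rw [Real.norm_eq_abs]
  nlinarith

lemma setIntegral_gap_update_sub_le [IsProbabilityMeasure D] (hd : 2 ≤ d)
    (hD : D.map Prod.fst = uniformSphere d)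
    (hw : ‖w‖ = 1) (ha : 0 < a) (ha2 : a ^ 2 = 1 - inner ℝ w (u : Amb d) ^ 2) (hb : 0 < b)
    (hb' : b ≤ a / √((d : ℝ) - 1) / 1000) (hp : p = (uniformSphere d).real (band b w))
    (hN : D.real (noiseSet u) ≤ p / 4000) :
    ∫ z in labelledBand b w, (gap u (update w z) - gap (u : Amb d) w) ∂D ≤
      - (b * (a / √((d : ℝ) - 1)) / 8 * p) := by
  have hd1 : (1 : ℝ) ≤ d - 1 := by
    have : (2 : ℝ) ≤ d := by exact_mod_cast hd
    linarith
  have hr0 : 0 < √((d : ℝ) - 1) := Real.sqrt_pos.2 (by linarith)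
  have hp0 : 0 ≤ p := hp ▸ measureReal_nonneg
  have ha1 : a ≤ 1 := by
    have := sq_nonneg (inner ℝ w (u : Amb d))
    nlinarith
  have hr1 : 1 ≤ √((d : ℝ) - 1) := Real.one_le_sqrt.2 hd1
  have hq1 : a / √((d : ℝ) - 1) ≤ 1 := (div_le_one hr0).2 (ha1.trans hr1)
  have h1 := setIntegral_labelledBand_inner_sub_abs_le hd hD hw ha ha2 hb (by linarith) hp
  have h2 := setIntegral_labelledBand_inner_sq_le hd hD hw ha ha2 hb hp
  rw [show a / (4 * √((d : ℝ) - 1)) = a / √((d : ℝ) - 1) / 4 by rw [div_div, mul_comm]] at h1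
  rw [show a ^ 2 / ((d : ℝ) - 1) = (a / √((d : ℝ) - 1)) ^ 2 by
    rw [div_pow, Real.sq_sqrt (by linarith)]] at h2
  set q := a / √((d : ℝ) - 1) with hq
  have hq0 : 0 < q := div_pos ha hr0
  -- On the noise set the loss is estimated by `2 |t| ≤ τ + t² / τ`. With this `τ` the first term
  -- costs at most `q / 100` and the second about `q / 20`, leaving more than half of the main gain
  -- `q / 4`.
  set τ := 40 * q with hτ
  have hτ0 : 0 < τ := by positivity
  have hNi : Integrable ((noiseSet u).indicator (1 : Example d → ℝ))
      (D.restrict (labelledBand b w)) :=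
    (integrable_const (1 : ℝ)).indicator (measurableSet_noiseSet u)
  have hN2 : ∫ z in labelledBand b w, (noiseSet u).indicator (1 : Example d → ℝ) z ∂D ≤
      D.real (noiseSet u) := by
    rw [integral_indicator_one (measurableSet_noiseSet u)]
    exact ENNReal.toReal_mono (measure_ne_top _ _) (Measure.restrict_apply_le _ _)
  have i1 : Integrable (fun z : Example d => (inner ℝ (u : Amb d) (z.1 : Amb d) -
      |inner ℝ (u : Amb d) (z.1 : Amb d)|) / 2) (D.restrict (labelledBand b w)) :=
    integrable_labelledBand_inner (f := fun t => (t - |t|) / 2) (by fun_prop)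
  have i2 : Integrable (fun z : Example d => inner ℝ (u : Amb d) (z.1 : Amb d) ^ 2)
      (D.restrict (labelledBand b w)) :=
    integrable_labelledBand_inner (f := fun t => t ^ 2) (by fun_prop)
  have hle : ∫ z in labelledBand b w, (gap u (update w z) - gap (u : Amb d) w) ∂D ≤
      ∫ z in labelledBand b w, (b * ((inner ℝ (u : Amb d) (z.1 : Amb d) -
        |inner ℝ (u : Amb d) (z.1 : Amb d)|) / 2) + (b * τ *
          (noiseSet u).indicator (1 : Example d → ℝ) z +
          b / τ * inner ℝ (u : Amb d) (z.1 : Amb d) ^ 2)) ∂D := by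
    refine setIntegral_mono_on (integrable_gap_update_sub hb)
      ((i1.const_mul b).add ((hNi.const_mul (b * τ)).add (i2.const_mul (b / τ))))
      (measurableSet_labelledBand b w) fun z hz => ?_
    refine (gap_update_sub_le hb u w hz).trans ?_
    rw [add_le_add_iff_left]
    set t := inner ℝ (u : Amb d) (z.1 : Amb d)
    have ht : |t| ^ 2 = t ^ 2 := sq_abs t
    have hnn : 0 ≤ b / τ * t ^ 2 := by positivity
    by_cases hz' : z ∈ noiseSet u
    · rw [Set.indicator_of_mem hz', Pi.one_apply]
      have : b * τ * 1 + b / τ * t ^ 2 - 2 * b * 1 * |t| = b / τ * (τ - |t|) ^ 2 := by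
        rw [← ht]; field_simp; ring
      have h0 : 0 ≤ b / τ * (τ - |t|) ^ 2 := by positivity
      linarith
    · rw [Set.indicator_of_notMem hz']
      linarith
  have i3 : Integrable (fun z : Example d => b * τ * (noiseSet u).indicator (1 : Example d → ℝ) z +
          b / τ * inner ℝ (u : Amb d) (z.1 : Amb d) ^ 2) (D.restrict (labelledBand b w)) :=
    (hNi.const_mul (b * τ)).add (i2.const_mul (b / τ))
  rw [integral_add (i1.const_mul b) i3, integral_add (hNi.const_mul (b * τ)) (i2.const_mul (b / τ)),
    integral_const_mul, integral_const_mul, integral_const_mul] at hle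
  refine hle.trans ?_
  have k1 := mul_le_mul_of_nonneg_left h1 hb.le
  have k2 := mul_le_mul_of_nonneg_left (hN2.trans hN) (by positivity : 0 ≤ b * τ)
  have k3 := mul_le_mul_of_nonneg_left h2 (by positivity : 0 ≤ b / τ)
  have hb2 : b ^ 2 ≤ q ^ 2 / 1000000 := by nlinarith
  have k4 : b / τ * (2 * (b ^ 2 + q ^ 2) * p) ≤ b * p * (q * (21 / 400)) := by
    have : 2 * (b ^ 2 + q ^ 2) / τ ≤ q * (21 / 400) := by
      rw [div_le_iff₀ hτ0, hτ]
      nlinarith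
    calc b / τ * (2 * (b ^ 2 + q ^ 2) * p) = b * p * (2 * (b ^ 2 + q ^ 2) / τ) := by ring
      _ ≤ _ := mul_le_mul_of_nonneg_left this (by positivity)
  have k5 : b * ((b - q / 4) * p) ≤ b * p * (q / 1000 - q / 4) := by
    have := mul_le_mul_of_nonneg_left hb' (by positivity : 0 ≤ b * p)
    linarith
  have k6 : b * τ * (p / 4000) = b * p * (q / 100) := by rw [hτ]; ring
  have k7 : 0 ≤ b * p * q := by positivity
  have k8 : b * q / 8 * p = b * p * q / 8 := by ring
  rw [k8]
  linarith

/-- The change is at most `2 b |u ⬝ x|`, and `u ⬝ x` has conditional second moment at most `2 (b² +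
q²)`, in which `b²` is negligible. -/
lemma setIntegral_gap_update_sub_sq_le [IsProbabilityMeasure D] (hd : 2 ≤ d)
    (hD : D.map Prod.fst = uniformSphere d)
    (hw : ‖w‖ = 1) (ha : 0 < a) (ha2 : a ^ 2 = 1 - inner ℝ w (u : Amb d) ^ 2) (hb : 0 < b)
    (hb' : b ≤ a / √((d : ℝ) - 1) / 1000) (hp : p = (uniformSphere d).real (band b w)) :
    ∫ z in labelledBand b w, (gap u (update w z) - gap (u : Amb d) w) ^ 2 ∂D ≤
      9 * (b * (a / √((d : ℝ) - 1))) ^ 2 * p := by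
  have hd1 : (1 : ℝ) ≤ d - 1 := by
    have : (2 : ℝ) ≤ d := by exact_mod_cast hd
    linarith
  have hr0 : 0 < √((d : ℝ) - 1) := Real.sqrt_pos.2 (by linarith)
  have hp0 : 0 ≤ p := hp ▸ measureReal_nonneg
  have h2 := setIntegral_labelledBand_inner_sq_le hd hD hw ha ha2 hb hp
  rw [show a ^ 2 / ((d : ℝ) - 1) = (a / √((d : ℝ) - 1)) ^ 2 by
    rw [div_pow, Real.sq_sqrt (by linarith)]] at h2
  set q := a / √((d : ℝ) - 1) with hq
  have hq0 : 0 < q := div_pos ha hr0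
  have i2 : Integrable (fun z : Example d => inner ℝ (u : Amb d) (z.1 : Amb d) ^ 2)
      (D.restrict (labelledBand b w)) :=
    integrable_labelledBand_inner (f := fun t => t ^ 2) (by fun_prop)
  have hpt : ∀ z ∈ labelledBand b w, (gap u (update w z) - gap (u : Amb d) w) ^ 2 ≤
      4 * b ^ 2 * inner ℝ (u : Amb d) (z.1 : Amb d) ^ 2 := fun z hz => by
    have := pow_le_pow_left₀ (abs_nonneg _) (abs_gap_update_sub_le hb u w hz) 2
    rw [sq_abs, mul_pow, sq_abs] at this
    linarith
  have i3 : Integrable (fun z : Example d => (gap u (update w z) - gap (u : Amb d) w) ^ 2)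
      (D.restrict (labelledBand b w)) := by
    refine (i2.const_mul (4 * b ^ 2)).mono'
      (measurable_gap_update_sub.pow_const 2).aestronglyMeasurable ?_
    filter_upwards [ae_restrict_mem (measurableSet_labelledBand b w)] with z hz
    rw [Real.norm_eq_abs, abs_of_nonneg (sq_nonneg _)]
    exact hpt z hz
  have hle := setIntegral_mono_on i3 (i2.const_mul (4 * b ^ 2)) (measurableSet_labelledBand b w) hpt
  rw [integral_const_mul] at hle
  refine hle.trans ((mul_le_mul_of_nonneg_left h2 (by positivity)).trans ?_)
  have hb2 : b ^ 2 ≤ q ^ 2 / 8 := by nlinarith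
  have h3 := mul_le_mul_of_nonneg_left hb2 (by positivity : 0 ≤ b ^ 2 * p)
  have h4 : 9 * (b * q) ^ 2 * p = 9 * (b ^ 2 * p * q ^ 2) := by ring
  rw [h4]
  linarith

/-- The exponential moment of the potential contracts in one step. -/
theorem setIntegral_exp_gap_update_sub_le [IsProbabilityMeasure D] (hd : 2 ≤ d)
    (hD : D.map Prod.fst = uniformSphere d)
    (hw : ‖w‖ = 1) (ha : 0 < a) (ha2 : a ^ 2 = 1 - inner ℝ w (u : Amb d) ^ 2) (hb : 0 < b)
    (hb' : b ≤ a / √((d : ℝ) - 1) / 1000) (hp : p = (uniformSphere d).real (band b w))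
    (hN : D.real (noiseSet u) ≤ p / 4000) {lam : ℝ} (hlam : 0 ≤ lam)
    (hrange : ∀ z ∈ labelledBand b w, lam * |gap u (update w z) - gap (u : Amb d) w| ≤ 1)
    (hvar : 144 * (lam * (b * (a / √((d : ℝ) - 1)))) ≤ 1) :
    ∫ z in labelledBand b w, Real.exp (lam * (gap u (update w z) - gap (u : Amb d) w)) ∂D ≤
      (1 - lam * (b * (a / √((d : ℝ) - 1))) / 16) * p := by
  have h1 := setIntegral_gap_update_sub_le hd hD hw ha ha2 hb hb' hp hN
  have h2 := setIntegral_gap_update_sub_sq_le hd hD hw ha ha2 hb hb' hp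
  have hp0 : 0 ≤ p := hp ▸ measureReal_nonneg
  have i1 : Integrable (fun z : Example d => gap u (update w z) - gap (u : Amb d) w)
      (D.restrict (labelledBand b w)) := integrable_gap_update_sub hb
  have hbd : ∀ z ∈ labelledBand b w, |gap u (update w z) - gap (u : Amb d) w| ≤ 2 * b :=
    fun z hz => by
    have := abs_gap_update_sub_le hb u w hz
    have := abs_inner_le_one u z.1
    nlinarith
  have i2 : Integrable (fun z : Example d => (gap u (update w z) - gap (u : Amb d) w) ^ 2)
      (D.restrict (labelledBand b w)) := by
    refine Integrable.of_bound (measurable_gap_update_sub.pow_const 2).aestronglyMeasurable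
      ((2 * b) ^ 2) ?_
    filter_upwards [ae_restrict_mem (measurableSet_labelledBand b w)] with z hz
    rw [norm_pow]
    exact pow_le_pow_left₀ (norm_nonneg _) (hbd z hz) 2
  have hmem : ∀ z ∈ labelledBand b w, |lam * (gap u (update w z) - gap (u : Amb d) w)| ≤ 1 :=
    fun z hz => by rw [abs_mul, abs_of_nonneg hlam]; exact hrange z hz
  have i3 : Integrable (fun z : Example d =>
      Real.exp (lam * (gap u (update w z) - gap (u : Amb d) w)))
      (D.restrict (labelledBand b w)) := by
    refine Integrable.of_bound
      (measurable_gap_update_sub.const_mul lam).exp.aestronglyMeasurable (Real.exp 1) ?_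
    filter_upwards [ae_restrict_mem (measurableSet_labelledBand b w)] with z hz
    rw [Real.norm_eq_abs, Real.abs_exp]
    exact Real.exp_le_exp.2 (abs_le.1 (hmem z hz)).2
  have hle : ∫ z in labelledBand b w, Real.exp (lam * (gap u (update w z) - gap (u : Amb d) w)) ∂D ≤
      ∫ z in labelledBand b w, (1 + (lam * (gap u (update w z) - gap (u : Amb d) w) +
        lam ^ 2 * (gap u (update w z) - gap (u : Amb d) w) ^ 2)) ∂D := by
    refine setIntegral_mono_on i3 ((integrable_const 1).add ((i1.const_mul lam).add
      (i2.const_mul (lam ^ 2)))) (measurableSet_labelledBand b w) fun z hz => ?_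
    have := (abs_le.1 (Real.abs_exp_sub_one_sub_id_le (hmem z hz))).2
    rw [mul_pow] at this
    linarith
  have i4 : Integrable (fun z : Example d => lam * (gap u (update w z) - gap (u : Amb d) w) +
        lam ^ 2 * (gap u (update w z) - gap (u : Amb d) w) ^ 2)
      (D.restrict (labelledBand b w)) := (i1.const_mul lam).add (i2.const_mul (lam ^ 2))
  have hone : ∫ _ in labelledBand b w, (1 : ℝ) ∂D = p := by
    rw [setIntegral_const, smul_eq_mul, mul_one, measureReal_def, measure_labelledBand hD, hp,
      measureReal_def]
  rw [integral_add (integrable_const 1) i4,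
    integral_add (i1.const_mul lam) (i2.const_mul (lam ^ 2)),
    integral_const_mul, integral_const_mul, hone] at hle
  refine hle.trans ?_
  have k1 := mul_le_mul_of_nonneg_left h1 hlam
  have k2 := mul_le_mul_of_nonneg_left h2 (sq_nonneg lam)
  have hr0 : 0 ≤ a / √((d : ℝ) - 1) := by positivity
  set q := a / √((d : ℝ) - 1)
  set y := lam * (b * q) with hy
  have hy0 : 0 ≤ y := by positivity
  have k3 : lam ^ 2 * (9 * (b * q) ^ 2 * p) = 9 * y ^ 2 * p := by rw [hy]; ring
  have k4 : lam * -(b * q / 8 * p) = - (y / 8 * p) := by rw [hy]; ring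
  -- By `144 y ≤ 1` the quadratic term of the exponential uses up at most half of the linear gain `y
  -- / 8`.
  have k5 : 9 * y ^ 2 * p ≤ y / 16 * p := mul_le_mul_of_nonneg_right (by nlinarith) hp0
  linarith

end Drift

/-! ### The Markov chain of single draws. -/

open Classical in
/-- The effect of one draw `z` on the state `(w, j)`, where `j` iterations are left: a rejected
example does not change the state, an accepted one updates `w` and uses up one iteration. -/
def next {d : ℕ} (b : ℝ) (s : Amb d × ℕ) (z : Example d) : Amb d × ℕ :=
  if s.2 ≠ 0 ∧ z ∈ labelledBand b s.1 then (update s.1 z, s.2 - 1) else s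

/-- The state after `n` draws from the stream `data`. -/
def trajectory {d : ℕ} (b : ℝ) (s : Amb d × ℕ) (data : Data d) : ℕ → Amb d × ℕ
  | 0 => s
  | n + 1 => next b (trajectory b s data n) (data n)

lemma measurable_next {d : ℕ} (b : ℝ) :
    Measurable fun q : (Amb d × ℕ) × Example d => next b q.1 q.2 := by
  have h1 : Measurable fun q : (Amb d × ℕ) × Example d => (q.1.1, q.2) :=
    (measurable_fst.comp measurable_fst).prodMk measurable_snd
  have h2 : Measurable fun q : (Amb d × ℕ) × Example d => q.1.2 :=
    measurable_snd.comp measurable_fst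
  refine Measurable.ite ?_ ?_ measurable_fst
  · exact (h2 (MeasurableSet.of_discrete (s := {k : ℕ | k ≠ 0}))).inter
      (h1 (measurableSet_labelledBand_prod b))
  · exact (measurable_update.comp h1).prodMk ((measurable_of_countable fun k : ℕ => k - 1).comp h2)

lemma norm_next {d : ℕ} (b : ℝ) (s : Amb d × ℕ) (z : Example d) : ‖(next b s z).1‖ = ‖s.1‖ := by
  unfold next
  split_ifs
  · exact norm_update _ _
  · rfl

lemma norm_trajectory {d : ℕ} (b : ℝ) (s : Amb d × ℕ) (data : Data d) (n : ℕ) :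
    ‖(trajectory b s data n).1‖ = ‖s.1‖ := by
  induction n with
  | zero => rfl
  | succ n ih => rw [trajectory, norm_next, ih]

lemma measurable_trajectory {d : ℕ} (b : ℝ) (s : Amb d × ℕ) {Ω : Type*} {m : MeasurableSpace Ω}
    {Z : ℕ → Ω → Example d} (n : ℕ) (hZ : ∀ i < n, Measurable[m] (Z i)) :
    Measurable[m] fun ω => trajectory b s (fun i => Z i ω) n := by
  induction n with
  | zero => exact measurable_const
  | succ n ih =>
    exact (measurable_next b).comp ((ih fun i hi => hZ i (by omega)).prodMk (hZ n (by omega)))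

/-- The state after `n` draws depends only on the examples with index below `n`. -/
lemma indepFun_trajectory {d : ℕ} (b : ℝ) (s : Amb d × ℕ) {Ω : Type*} [MeasurableSpace Ω]
    {P : Measure Ω} {Z : ℕ → Ω → Example d} (hZ : ∀ i, Measurable (Z i)) (hind : iIndepFun Z P)
    (n : ℕ) : IndepFun (fun ω => trajectory b s (fun i => Z i ω) n) (Z n) P := by
  have h : Indep (⨆ i ∈ Set.Iio n, MeasurableSpace.comap (Z i) inferInstance)
      (⨆ i ∈ ({n} : Set ℕ), MeasurableSpace.comap (Z i) inferInstance) P :=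
    indep_iSup_of_disjoint (fun i => (hZ i).comap_le) hind (by simp)
  rw [iSup_singleton] at h
  refine indep_of_indep_of_le_left h ?_
  refine Measurable.comap_le ?_
  refine measurable_trajectory b s n fun i hi => ?_
  exact (comap_measurable (Z i)).mono (le_iSup₂_of_le i hi le_rfl) le_rfl

lemma integrable_comp_of_le_one {α β : Type*} [MeasurableSpace α] [MeasurableSpace β]
    {μ : Measure α} [IsFiniteMeasure μ] {V : β → ℝ} (hV : Measurable V) (hV0 : ∀ s, 0 ≤ V s)
    (hV1 : ∀ s, V s ≤ 1) {f : α → β} (hf : Measurable f) : Integrable (fun x => V (f x)) μ := by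
  refine Integrable.of_bound (hV.comp hf).aestronglyMeasurable 1
    (Filter.Eventually.of_forall fun x => ?_)
  rw [Real.norm_eq_abs, abs_of_nonneg (hV0 _)]
  exact hV1 _

/-- A bounded function which decreases on average under `next`, as the number `n` of draws that
are left decreases, also decreases on average along the trajectory. -/
theorem integral_trajectory_le {d : ℕ} {D : Measure (Example d)} [IsProbabilityMeasure D]
    {b : ℝ} {V : ℕ → Amb d × ℕ → ℝ} (hV : ∀ n, Measurable (V n)) (hV0 : ∀ n s, 0 ≤ V n s)
    (hV1 : ∀ n s, V n s ≤ 1)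
    (hstep : ∀ n s, ‖s.1‖ = 1 → ∫ z, V n (next b s z) ∂D ≤ V (n + 1) s)
    {Ω : Type*} [MeasurableSpace Ω] {P : Measure Ω} [IsProbabilityMeasure P]
    {Z : ℕ → Ω → Example d} (hZ : ∀ i, Measurable (Z i)) (hlaw : ∀ i, P.map (Z i) = D)
    (hind : iIndepFun Z P) {s : Amb d × ℕ} (hs : ‖s.1‖ = 1) (n k : ℕ) :
    ∫ ω, V k (trajectory b s (fun i => Z i ω) n) ∂P ≤ V (k + n) s := by
  induction n generalizing k with
  | zero => simp [trajectory]
  | succ n ih =>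
    have hT := measurable_trajectory b s n (fun i _ => hZ i)
    have hm := (indepFun_iff_map_prod_eq_prod_map_map hT.aemeasurable (hZ n).aemeasurable).1
      (indepFun_trajectory b s hZ hind n)
    have hprob : IsProbabilityMeasure (P.map fun ω => trajectory b s (fun i => Z i ω) n) :=
      Measure.isProbabilityMeasure_map hT.aemeasurable
    rw [hlaw] at hm
    have hmeas : Measurable fun q : (Amb d × ℕ) × Example d => V k (next b q.1 q.2) :=
      (hV k).comp (measurable_next b)
    -- By independence the last draw can be integrated out first; one draw is thus traded for an
    -- increase of `k` by one.
    have e1 : ∫ ω, V k (trajectory b s (fun i => Z i ω) (n + 1)) ∂P =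
        ∫ ω, ∫ z, V k (next b (trajectory b s (fun i => Z i ω) n) z) ∂D ∂P := by
      have hsm : StronglyMeasurable fun t : Amb d × ℕ => ∫ z, V k (next b t z) ∂D :=
        hmeas.stronglyMeasurable.integral_prod_right'
      rw [← integral_map (f := fun t => ∫ z, V k (next b t z) ∂D) hT.aemeasurable
        hsm.aestronglyMeasurable,
        ← integral_prod (fun q : (Amb d × ℕ) × Example d => V k (next b q.1 q.2))
          (integrable_comp_of_le_one (hV k) (hV0 k) (hV1 k) (measurable_next b)), ← hm,
        integral_map (hT.prodMk (hZ n)).aemeasurable hmeas.aestronglyMeasurable]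
      rfl
    rw [e1]
    refine le_trans (integral_mono_of_nonneg ?_
      (integrable_comp_of_le_one (hV _) (hV0 _) (hV1 (k + 1)) hT) ?_) ((ih (k + 1)).trans_eq ?_)
    · exact Filter.Eventually.of_forall fun ω => integral_nonneg fun z => hV0 _ _
    · exact Filter.Eventually.of_forall fun ω => hstep k _ (by rw [norm_trajectory, hs])
    · congr 1; omega

/-! ### The supermartingale that bounds the failure probability. -/

/-- Bound for the probability that the gap exceeds `G / 4` after the iterations that are left. -/
def potential {d : ℕ} (u : Amb d) (lam ρ G κ : ℝ) (s : Amb d × ℕ) : ℝ :=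
  ρ ^ s.2 * Real.exp (lam * (gap u s.1 - G / 4)) + Real.exp (lam * (gap u s.1 - 3 * G / 2)) +
    s.2 * κ

/-- Bound for the probability that `n` draws do not suffice for `j` iterations. -/
def budgetBound (q : ℝ) (n j : ℕ) : ℝ := (2 ^ j - 1) * q ^ n

/-- Bound for the failure probability with `n` draws left. -/
def failureBound {d : ℕ} (u : Amb d) (lam ρ G κ q : ℝ) (n : ℕ) (s : Amb d × ℕ) : ℝ :=
  min 1 (potential u lam ρ G κ s + budgetBound q n s.2)

lemma measurable_failureBound {d : ℕ} (u : Amb d) (lam ρ G κ q : ℝ) (n : ℕ) :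
    Measurable (failureBound u lam ρ G κ q n) := by
  have h1 : Measurable fun s : Amb d × ℕ => gap u s.1 := (measurable_gap u).comp measurable_fst
  have h2 : ∀ f : ℕ → ℝ, Measurable fun s : Amb d × ℕ => f s.2 := fun f =>
    (measurable_of_countable f).comp measurable_snd
  refine measurable_const.min (Measurable.add (Measurable.add (Measurable.add ?_ ?_) ?_) ?_)
  · exact (h2 fun j => ρ ^ j).mul ((h1.sub_const _).const_mul _).exp
  · exact ((h1.sub_const _).const_mul _).exp
  · exact h2 fun j => (j : ℝ) * κ
  · exact h2 fun j => budgetBound q n j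

lemma budgetBound_nonneg {q : ℝ} (hq : 0 ≤ q) (n j : ℕ) : 0 ≤ budgetBound q n j :=
  mul_nonneg (sub_nonneg.2 (one_le_pow₀ (by norm_num))) (pow_nonneg hq n)

lemma potential_nonneg {d : ℕ} (u : Amb d) {lam ρ G κ : ℝ} (hρ : 0 ≤ ρ) (hκ : 0 ≤ κ)
    (s : Amb d × ℕ) : 0 ≤ potential u lam ρ G κ s := by
  unfold potential; positivity

section Step

variable {d : ℕ} {D : Measure (Example d)} [IsProbabilityMeasure D] {u : Amb d}
  {b lam ρ G κ p₀ : ℝ}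

/-- Both exponentials are multiplied by the same random factor. Its mean is at most `ρ` where the
drift applies, which is what the weight `ρ ^ k` needs. Below `G / 8` the factor is only at most `e`,
but both exponentials are then tiny and the summand `κ` released by this iteration pays for them. -/
lemma setIntegral_potential_update_le (hlam : 0 ≤ lam) (hρ : 0 ≤ ρ) (hρ1 : ρ ≤ 1)
    (hκ : 2 * Real.exp (1 - lam * G / 8) ≤ κ)
    (hdrift : ∀ w : Amb d, ‖w‖ = 1 → G / 8 ≤ gap u w → gap u w ≤ 3 * G / 2 →
      ∫ z in labelledBand b w, Real.exp (lam * (gap u (update w z) - gap u w)) ∂D ≤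
        ρ * D.real (labelledBand b w))
    (hrange : ∀ w : Amb d, ‖w‖ = 1 → gap u w ≤ 3 * G / 2 → ∀ z ∈ labelledBand b w,
      lam * |gap u (update w z) - gap u w| ≤ 1)
    {w : Amb d} (hw : ‖w‖ = 1) (hgap : gap u w ≤ 3 * G / 2) (k : ℕ) :
    IntegrableOn (fun z => potential u lam ρ G κ (update w z, k)) (labelledBand b w) D ∧
    ∫ z in labelledBand b w, potential u lam ρ G κ (update w z, k) ∂D ≤
      potential u lam ρ G κ (w, k + 1) * D.real (labelledBand b w) := by
  set A := Real.exp (lam * (gap u w - G / 4)) with hA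
  set B := Real.exp (lam * (gap u w - 3 * G / 2)) with hB
  have hA0 : 0 < A := Real.exp_pos _
  have hB0 : 0 < B := Real.exp_pos _
  have hκ0 : 0 ≤ κ := le_trans (by positivity) hκ
  have hp0 : 0 ≤ D.real (labelledBand b w) := measureReal_nonneg
  have hrw : ∀ z, potential u lam ρ G κ (update w z, k) =
      (ρ ^ k * A + B) * Real.exp (lam * (gap u (update w z) - gap u w)) + k * κ := fun z => by
    have e : ∀ c, Real.exp (lam * (gap u (update w z) - c)) =
        Real.exp (lam * (gap u w - c)) * Real.exp (lam * (gap u (update w z) - gap u w)) :=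
      fun c => by rw [← Real.exp_add]; congr 1; ring
    simp only [potential]
    rw [e (G / 4), e (3 * G / 2), ← hA, ← hB]
    ring
  have hexp : ∀ z ∈ labelledBand b w,
      Real.exp (lam * (gap u (update w z) - gap u w)) ≤ Real.exp 1 := fun z hz =>
    Real.exp_le_exp.2 ((mul_le_mul_of_nonneg_left (le_abs_self _) hlam).trans
      (hrange w hw hgap z hz))
  have hmeas : Measurable fun z : Example d => gap u (update w z) - gap u w :=
    ((measurable_gap _).comp (measurable_update.comp (measurable_const.prodMk measurable_id))).sub
      measurable_const
  have hint : IntegrableOn (fun z => Real.exp (lam * (gap u (update w z) - gap u w)))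
      (labelledBand b w) D := by
    refine Integrable.of_bound (hmeas.const_mul lam).exp.aestronglyMeasurable (Real.exp 1) ?_
    filter_upwards [ae_restrict_mem (measurableSet_labelledBand b w)] with z hz
    rw [Real.norm_eq_abs, Real.abs_exp]
    exact hexp z hz
  simp_rw [hrw]
  refine ⟨(hint.const_mul _).add (integrable_const _), ?_⟩
  rw [integral_add (hint.const_mul _) (integrable_const _), integral_const_mul, setIntegral_const,
    smul_eq_mul]
  have hρk : ρ ^ k ≤ 1 := pow_le_one₀ hρ hρ1
  have hρk0 : 0 ≤ ρ ^ k := pow_nonneg hρ k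
  have hgoal : potential u lam ρ G κ (w, k + 1) * D.real (labelledBand b w) =
      (ρ ^ (k + 1) * A + B + κ) * D.real (labelledBand b w) +
        D.real (labelledBand b w) * (k * κ) := by
    simp only [potential]; push_cast; ring
  rw [hgoal, add_le_add_iff_right]
  rcases le_total (G / 8) (gap u w) with h | h
  · refine (mul_le_mul_of_nonneg_left (hdrift w hw h hgap) (by positivity)).trans ?_
    rw [← mul_assoc]
    refine mul_le_mul_of_nonneg_right ?_ hp0
    rw [pow_succ]
    nlinarith
  · have h1 : ∫ z in labelledBand b w, Real.exp (lam * (gap u (update w z) - gap u w)) ∂D ≤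
        Real.exp 1 * D.real (labelledBand b w) := by
      refine (setIntegral_mono_on hint (integrable_const (Real.exp 1))
        (measurableSet_labelledBand b w) hexp).trans_eq ?_
      rw [setIntegral_const, smul_eq_mul, mul_comm]
    refine (mul_le_mul_of_nonneg_left h1 (by positivity)).trans ?_
    rw [← mul_assoc]
    refine mul_le_mul_of_nonneg_right ?_ hp0
    have hA1 : A * Real.exp 1 ≤ Real.exp (1 - lam * G / 8) := by
      rw [hA, ← Real.exp_add]
      exact Real.exp_le_exp.2 (by nlinarith)
    have hB1 : B * Real.exp 1 ≤ Real.exp (1 - lam * G / 8) := by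
      rw [hB, ← Real.exp_add]
      exact Real.exp_le_exp.2 (by nlinarith)
    have h2 : ρ ^ k * (A * Real.exp 1) ≤ A * Real.exp 1 :=
      mul_le_of_le_one_left (by positivity) hρk
    have h3 : 0 ≤ ρ ^ (k + 1) * A := by positivity
    nlinarith

lemma integral_failureBound_next_le (hlam : 0 ≤ lam) (hρ : 0 ≤ ρ) (hρ1 : ρ ≤ 1)
    (hκ : 2 * Real.exp (1 - lam * G / 8) ≤ κ)
    (hdrift : ∀ w : Amb d, ‖w‖ = 1 → G / 8 ≤ gap u w → gap u w ≤ 3 * G / 2 →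
      ∫ z in labelledBand b w, Real.exp (lam * (gap u (update w z) - gap u w)) ∂D ≤
        ρ * D.real (labelledBand b w))
    (hrange : ∀ w : Amb d, ‖w‖ = 1 → gap u w ≤ 3 * G / 2 → ∀ z ∈ labelledBand b w,
      lam * |gap u (update w z) - gap u w| ≤ 1)
    (hp₀ : 0 ≤ p₀) (hp₁ : p₀ ≤ 1)
    (hband : ∀ w : Amb d, ‖w‖ = 1 → p₀ ≤ D.real (labelledBand b w)) (n : ℕ) (s : Amb d × ℕ)
    (hs : ‖s.1‖ = 1) :
    ∫ z, failureBound u lam ρ G κ (1 - p₀ / 2) n (next b s z) ∂D ≤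
      failureBound u lam ρ G κ (1 - p₀ / 2) (n + 1) s := by
  obtain ⟨w, j⟩ := s
  have hκ0 : 0 ≤ κ := le_trans (by positivity) hκ
  have hq : 0 ≤ 1 - p₀ / 2 := by linarith
  set q := 1 - p₀ / 2 with hq_def
  set F := failureBound u lam ρ G κ q with hF
  have hF0 : ∀ n s, 0 ≤ F n s := fun n s => le_min zero_le_one
    (add_nonneg (potential_nonneg u hρ hκ0 s) (budgetBound_nonneg hq _ _))
  have hF1 : ∀ n s, F n s ≤ 1 := fun n s => min_le_left _ _
  have hint : Integrable (fun z => F n (next b (w, j) z)) D :=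
    integrable_comp_of_le_one (measurable_failureBound u lam ρ G κ q n) (hF0 n) (hF1 n)
      ((measurable_next b).comp (measurable_const.prodMk measurable_id))
  rcases j with _ | k
  -- With no iteration left the state is frozen, and `2 ^ 0 - 1 = 0` makes the bound independent of
  -- the draws left.
  · have h1 : ∀ z, F n (next b (w, 0) z) = F (n + 1) (w, 0) := fun z => by
      simp [hF, failureBound, next, budgetBound]
    simp_rw [h1]
    simp
  · refine le_min ?_ ?_
    · refine (integral_mono hint (integrable_const 1) fun z => hF1 _ _).trans ?_
      simp
    · by_cases hgap : gap u w ≤ 3 * G / 2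
      swap
      -- After an escape the second exponential alone is at least 1, so nothing about the dynamics
      -- there is needed.
      · have h1 : 1 ≤ Real.exp (lam * (gap u w - 3 * G / 2)) :=
          Real.one_le_exp (mul_nonneg hlam (by linarith))
        have h2 : ∫ z, F n (next b (w, k + 1) z) ∂D ≤ 1 := by
          refine (integral_mono hint (integrable_const 1) fun z => hF1 _ _).trans ?_
          simp
        refine h2.trans (h1.trans ?_)
        have h3 := budgetBound_nonneg hq (n + 1) (k + 1)
        have h4 : 0 ≤ ρ ^ (k + 1) * Real.exp (lam * (gap u w - G / 4)) + ((k + 1 : ℕ) : ℝ) * κ := by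
          positivity
        simp only [potential]
        linarith
      · obtain ⟨hi, hle⟩ := setIntegral_potential_update_le hlam hρ hρ1 hκ hdrift hrange hs
          hgap k
        have hB := measurableSet_labelledBand b w
        set B := labelledBand b w
        have hp := hband w hs
        have hpc : D.real Bᶜ = 1 - D.real B := probReal_compl_eq_one_sub hB
        rw [← integral_add_compl hB hint]
        have h1 : ∫ z in B, F n (next b (w, k + 1) z) ∂D ≤
            (potential u lam ρ G κ (w, k + 1) + budgetBound q n k) * D.real B := by
          refine (setIntegral_mono_on hint.integrableOn (hi.add (integrable_const
            (budgetBound q n k))) hB fun z hz => ?_).trans ?_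
          · have : next b (w, k + 1) z = (update w z, k) := by
              simp only [next]; rw [if_pos ⟨by simp, hz⟩]; simp
            rw [this]
            exact min_le_right _ _
          · rw [integral_add' hi (integrable_const _), setIntegral_const, smul_eq_mul]
            linarith
        have h2 : ∫ z in Bᶜ, F n (next b (w, k + 1) z) ∂D ≤
            (potential u lam ρ G κ (w, k + 1) + budgetBound q n (k + 1)) * (1 - D.real B) := by
          refine (setIntegral_mono_on hint.integrableOn (integrable_const
            (potential u lam ρ G κ (w, k + 1) + budgetBound q n (k + 1))) hB.compl
            fun z hz => ?_).trans ?_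
          · have : next b (w, k + 1) z = (w, k + 1) := by
              simp only [next]; rw [if_neg fun h => hz h.2]
            rw [this]
            exact min_le_right _ _
          · rw [setIntegral_const, smul_eq_mul, hpc, mul_comm]
        have h3 : budgetBound q n k * D.real B + budgetBound q n (k + 1) * (1 - D.real B) ≤
            budgetBound q (n + 1) (k + 1) := by
          simp only [budgetBound]
          have hqn : 0 ≤ q ^ n := pow_nonneg hq n
          have h2k : (1 : ℝ) ≤ 2 ^ k := one_le_pow₀ (by norm_num)
          rw [pow_succ q, pow_succ 2]
          -- An acceptance halves `2 ^ j` and has probability at least `p₀`, so the mean of `2 ^ j`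
          -- contracts by the factor `1 - p₀ / 2`.
          have : (2 ^ k - 1) * D.real B + (2 ^ k * 2 - 1) * (1 - D.real B) ≤
              (2 ^ k * 2 - 1 : ℝ) * q := by
            rw [hq_def]
            nlinarith
          nlinarith [mul_le_mul_of_nonneg_right this hqn]
        linarith

/-- The trajectory completes its iterations within `n` draws and reaches a small gap, except with
the probability given by `failureBound`. -/
theorem le_measure_trajectory_success (hlam : 0 ≤ lam) (hρ : 0 ≤ ρ) (hρ1 : ρ ≤ 1)
    (hκ : 2 * Real.exp (1 - lam * G / 8) ≤ κ)
    (hdrift : ∀ w : Amb d, ‖w‖ = 1 → G / 8 ≤ gap u w → gap u w ≤ 3 * G / 2 →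
      ∫ z in labelledBand b w, Real.exp (lam * (gap u (update w z) - gap u w)) ∂D ≤
        ρ * D.real (labelledBand b w))
    (hrange : ∀ w : Amb d, ‖w‖ = 1 → gap u w ≤ 3 * G / 2 → ∀ z ∈ labelledBand b w,
      lam * |gap u (update w z) - gap u w| ≤ 1)
    (hp₀ : 0 ≤ p₀) (hp₁ : p₀ ≤ 1)
    (hband : ∀ w : Amb d, ‖w‖ = 1 → p₀ ≤ D.real (labelledBand b w))
    {Ω : Type*} [MeasurableSpace Ω] {P : Measure Ω} [IsProbabilityMeasure P]
    {Z : ℕ → Ω → Example d} (hZ : ∀ i, Measurable (Z i)) (hlaw : ∀ i, P.map (Z i) = D)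
    (hind : iIndepFun Z P) {s : Amb d × ℕ} (hs : ‖s.1‖ = 1) (n : ℕ) {δ : ℝ}
    (hδ : potential u lam ρ G κ s + budgetBound (1 - p₀ / 2) n s.2 ≤ δ) :
    ∃ E : Set Ω, MeasurableSet E ∧ ENNReal.ofReal (1 - δ) ≤ P E ∧
      ∀ ω ∈ E, (trajectory b s (fun i => Z i ω) n).2 = 0 ∧
        gap u (trajectory b s (fun i => Z i ω) n).1 ≤ G / 4 := by
  have hκ0 : 0 ≤ κ := le_trans (by positivity) hκ
  have hq : 0 ≤ 1 - p₀ / 2 := by linarith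
  have hF0 : ∀ n s, 0 ≤ failureBound u lam ρ G κ (1 - p₀ / 2) n s := fun n s => le_min zero_le_one
    (add_nonneg (potential_nonneg u hρ hκ0 s) (budgetBound_nonneg hq _ _))
  have hF1 : ∀ n s, failureBound u lam ρ G κ (1 - p₀ / 2) n s ≤ 1 := fun n s => min_le_left _ _
  have hFm := measurable_failureBound u lam ρ G κ (1 - p₀ / 2)
  have hT := measurable_trajectory b s n (fun i _ => hZ i)
  have hmain := integral_trajectory_le hFm hF0 hF1 (integral_failureBound_next_le hlam hρ hρ1 hκ
    hdrift hrange hp₀ hp₁ hband) hZ hlaw hind hs n 0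
  rw [zero_add] at hmain
  set S : Set (Amb d × ℕ) := {t | t.2 = 0 ∧ gap u t.1 ≤ G / 4} with hS
  have hSm : MeasurableSet S := by
    refine MeasurableSet.inter ?_ ?_
    · exact measurable_snd (MeasurableSet.of_discrete (s := {k : ℕ | k = 0}))
    · exact measurableSet_le ((measurable_gap u).comp measurable_fst) measurable_const
  set E : Set Ω := (fun ω => trajectory b s (fun i => Z i ω) n) ⁻¹' S
  have hE : MeasurableSet E := hT hSm
  refine ⟨E, hE, ?_, fun ω hω => hω⟩
  have hbad : P.real Eᶜ ≤ δ := by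
    rw [← integral_indicator_one hE.compl]
    refine le_trans (integral_mono ((integrable_const (1 : ℝ)).indicator hE.compl)
      (integrable_comp_of_le_one (hFm 0) (hF0 0) (hF1 0) hT) fun ω => ?_)
      (hmain.trans ((min_le_right _ _).trans hδ))
    by_cases hω : ω ∈ E
    · rw [Set.indicator_of_notMem (by simpa using hω)]
      exact hF0 _ _
    · rw [Set.indicator_of_mem (by simpa using hω), Pi.one_apply]
      refine le_min le_rfl ?_
      set t := trajectory b s (fun i => Z i ω) n with ht
      have htS : t ∉ S := hω
      rcases Nat.eq_zero_or_pos t.2 with h0 | h0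
      · have hg : G / 4 < gap u t.1 := by
          by_contra hcon
          exact htS ⟨h0, not_lt.1 hcon⟩
        have h1 : 1 ≤ Real.exp (lam * (gap u t.1 - G / 4)) :=
          Real.one_le_exp (mul_nonneg hlam (by linarith))
        have h2 := Real.exp_pos (lam * (gap u t.1 - 3 * G / 2))
        simp only [potential, budgetBound, h0]
        simp only [pow_zero, Nat.cast_zero]
        linarith
      -- With no draws left, an unfinished run has `2 ^ j - 1 ≥ 1`.
      · have h1 : (2 : ℝ) ≤ 2 ^ t.2 := by
          simpa using pow_le_pow_right₀ (one_le_two : (1 : ℝ) ≤ 2) h0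
        have h2 := potential_nonneg u (lam := lam) (G := G) hρ hκ0 t
        simp only [budgetBound, pow_zero]
        linarith
  rw [probReal_compl_eq_one_sub hE, measureReal_def] at hbad
  rw [ENNReal.ofReal_le_iff_le_toReal (measure_ne_top _ _)]
  linarith

end Step

/-! ### Results and costs of the program. -/

section Program

variable {d : ℕ} {α β : Type}

lemma Prog.bind_apply (x : Prog d α) (f : α → Prog d β) (data : Data d) (r : Resources) :
    (x >>= f) data r = (x data r).bind fun p => f p.1 data p.2 := rfl

lemma Prog.pure_apply (a : α) (data : Data d) (r : Resources) :
    (pure a : Prog d α) data r = some (a, r) := rfl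

/-- `r` after `k` more elementary steps. -/
def Resources.addTime (r : Resources) (k : ℕ) : Resources := { r with time := r.time + k }

@[simp]
lemma Resources.addTime_addTime (r : Resources) (k l : ℕ) :
    (r.addTime k).addTime l = r.addTime (k + l) := by
  simp [Resources.addTime, add_assoc]

lemma step_apply (k : ℕ) (data : Data d) (r : Resources) :
    step k data r = some ((), r.addTime k) := rfl

lemma add_apply (a b : ℝ) (data : Data d) (r : Resources) :
    add a b data r = some (a + b, r.addTime 1) := rfl

lemma sub_apply (a b : ℝ) (data : Data d) (r : Resources) :
    sub a b data r = some (a - b, r.addTime 1) := rfl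

lemma mul_apply (a b : ℝ) (data : Data d) (r : Resources) :
    mul a b data r = some (a * b, r.addTime 1) := rfl

lemma half_apply (a : ℝ) (data : Data d) (r : Resources) :
    half a data r = some (a / 2, r.addTime 1) := rfl

open Classical in
lemma le_apply (a b : ℝ) (data : Data d) (r : Resources) :
    le a b data r = some (decide (a ≤ b), r.addTime 1) := rfl

open Classical in
lemma lt_apply (a b : ℝ) (data : Data d) (r : Resources) :
    lt a b data r = some (decide (a < b), r.addTime 1) := rfl

lemma write_apply (v : Vec d) (i : Fin d) (a : ℝ) (data : Data d) (r : Resources) :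
    write v i a data r = some (Function.update v i a, r.addTime 1) := rfl

lemma repeatAtMost_succ_apply (body : Prog d (Option α)) (k : ℕ) (data : Data d) (r : Resources) :
    repeatAtMost body (k + 1) data r = (body data r).bind fun p =>
      match p.1 with
      | some a => some (a, p.2)
      | none => repeatAtMost body k data p.2 := by
  rw [repeatAtMost, Prog.bind_apply]
  congr 1
  funext ⟨o, r'⟩
  cases o <;> rfl

lemma repeatUntil_of_some {body : Prog d (Option α)} {data : Data d} {r r' : Resources} {a : α}
    (h : body data r = some (some a, r')) : repeatUntil body data r = some (a, r') := by
  classical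
  have hk : ∀ k, repeatAtMost body (k + 1) data r = some (a, r') := fun k => by
    rw [repeatAtMost_succ_apply, h]; rfl
  have hex : ∃ k, repeatAtMost body k data r ≠ none := ⟨1, by rw [hk]; simp⟩
  rw [repeatUntil, dif_pos hex]
  have h0 := Nat.find_spec hex
  rcases hn : Nat.find hex with _ | n
  · rw [hn] at h0; exact absurd rfl h0
  · rw [hk]

/-- A rejected round shifts the least sufficient number of rounds by one, and nontermination is
unaffected. -/
lemma repeatUntil_of_none {body : Prog d (Option α)} {data : Data d} {r r' : Resources}
    (h : body data r = some (none, r')) : repeatUntil body data r = repeatUntil body data r' := by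
  classical
  have hk : ∀ k, repeatAtMost body (k + 1) data r = repeatAtMost body k data r' := fun k => by
    rw [repeatAtMost_succ_apply, h]; rfl
  by_cases hex : ∃ k, repeatAtMost body k data r' ≠ none
  · have hex' : ∃ k, repeatAtMost body k data r ≠ none := by
      obtain ⟨k, hk'⟩ := hex
      exact ⟨k + 1, by rwa [hk]⟩
    rw [repeatUntil, repeatUntil, dif_pos hex, dif_pos hex', ← hk]
    congr 1
    rw [Nat.find_eq_iff]
    refine ⟨by rw [hk]; exact Nat.find_spec hex, fun n hn => ?_⟩
    rcases n with _ | n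
    · simp [repeatAtMost]
    · rw [hk]; exact Nat.find_min hex (by omega)
  · have hex' : ¬ ∃ k, repeatAtMost body k data r ≠ none := by
      rintro ⟨k, hk'⟩
      rcases k with _ | k
      · exact hk' rfl
      · exact hex ⟨k, by rwa [← hk]⟩
    rw [repeatUntil, repeatUntil, dif_neg hex, dif_neg hex']

lemma foldlM_dot (w x : Vec d) (l : List (Fin d)) (s : ℝ) (data : Data d) (r : Resources) :
    (l.foldlM (init := s) fun s i => (do
      step 1
      let p ← mul (w i) (x i)
      add s p : Prog d ℝ)) data r =
      some (s + (l.map fun i => w i * x i).sum, r.addTime (3 * l.length)) := by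
  induction l generalizing s r with
  | nil => simp [Prog.pure_apply, Resources.addTime]
  | cons i l ih =>
    simp only [List.foldlM_cons, Prog.bind_apply, step_apply, Option.bind_some, mul_apply,
      add_apply]
    rw [ih]
    simp only [Resources.addTime_addTime, List.map_cons, List.sum_cons, List.length_cons]
    congr 2
    · ring
    · congr 1; ring

lemma dot_apply (w : Vec d) (x : Vec d) (data : Data d) (r : Resources) :
    dot w x data r = some (inner ℝ (WithLp.toLp 2 w) (WithLp.toLp 2 x), r.addTime (3 * d)) := by
  rw [dot, foldlM_dot, zero_add, List.length_finRange]
  congr 2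
  rw [PiLp.inner_apply, ← List.sum_ofFn, List.ofFn_eq_map]
  congr 2
  funext i
  simp [mul_comm]

open Classical in
lemma foldlM_subScaled (c : ℝ) (x : Vec d) (l : List (Fin d)) (hl : l.Nodup) (v : Vec d)
    (data : Data d) (r : Resources) :
    (l.foldlM (init := v) fun v i => (do
      step 1
      let p ← mul c (x i)
      let a ← sub (v i) p
      write v i a : Prog d (Vec d))) data r =
      some ((fun i => if i ∈ l then v i - c * x i else v i), r.addTime (4 * l.length)) := by
  induction l generalizing v r with
  | nil => simp [Prog.pure_apply, Resources.addTime]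
  | cons i l ih =>
    rw [List.nodup_cons] at hl
    simp only [List.foldlM_cons, Prog.bind_apply, step_apply, Option.bind_some, mul_apply,
      sub_apply, write_apply]
    rw [ih hl.2]
    simp only [Resources.addTime_addTime, List.length_cons]
    congr 2
    · funext j
      by_cases hj : j = i
      · subst hj; simp [hl.1]
      · simp [hj]
    · congr 1; ring

lemma subScaled_apply (w : Vec d) (c : ℝ) (x : Vec d) (data : Data d) (r : Resources) :
    subScaled w c x data r = some ((fun i => w i - c * x i), r.addTime (4 * d)) := by
  classical
  rw [subScaled, foldlM_subScaled _ _ _ (List.nodup_finRange d), List.length_finRange]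
  simp

open Classical in
lemma inBand_apply (b s : ℝ) (data : Data d) (r : Resources) :
    ∃ k ≤ 3, inBand b s data r = some (decide (b / 2 ≤ s ∧ s ≤ b), r.addTime k) := by
  simp only [inBand, Prog.bind_apply, half_apply, Option.bind_some, le_apply]
  by_cases h : b / 2 ≤ s
  · refine ⟨3, le_rfl, ?_⟩
    simp [h, le_apply]
  · refine ⟨2, by norm_num, ?_⟩
    simp [h, Prog.pure_apply]

/-- `r` after drawing one example and `k` elementary steps. -/
def Resources.addDraw (r : Resources) (k : ℕ) : Resources :=
  { r with draws := r.draws + 1, time := r.time + k }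

open Classical in
lemma rejectionSample_body_apply (b : ℝ) (w : Amb d) (data : Data d) (r : Resources) :
    ∃ k ≤ 4 * d + 4, ((do
      step 1
      let (n, x) ← draw
      let s ← dot (WithLp.ofLp w) x
      if ← inBand b s then return some (n, x, s) else return none :
        Prog d (Option (ℕ × Vec d × ℝ)))) data r =
      some (if data r.draws ∈ labelledBand b w then
        some (r.draws, WithLp.ofLp ((data r.draws).1 : Amb d), inner ℝ w ((data r.draws).1 : Amb d))
        else none, r.addDraw k) := by
  obtain ⟨k, hk, hB⟩ := inBand_apply b (inner ℝ w ((data r.draws).1 : Amb d)) data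
    ((r.addDraw (1 + d)).addTime (3 * d))
  refine ⟨1 + d + 3 * d + k, by omega, ?_⟩
  have hdraw : draw data (r.addTime 1) =
      some ((r.draws, WithLp.ofLp ((data r.draws).1 : Amb d)), r.addDraw (1 + d)) := by
    simp [draw, Resources.addTime, Resources.addDraw, add_assoc]
  have hr : ((r.addDraw (1 + d)).addTime (3 * d)).addTime k = r.addDraw (1 + d + 3 * d + k) := by
    simp [Resources.addTime, Resources.addDraw, add_assoc]
  simp only [Prog.bind_apply, step_apply, Option.bind_some, hdraw, dot_apply, hB, hr]
  by_cases h : data r.draws ∈ labelledBand b w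
  · have h' : b / 2 ≤ inner ℝ w ((data r.draws).1 : Amb d) ∧
      inner ℝ w ((data r.draws).1 : Amb d) ≤ b := h
    rw [if_pos h, if_pos (decide_eq_true h')]
    rfl
  · have h' : ¬ (b / 2 ≤ inner ℝ w ((data r.draws).1 : Amb d) ∧
      inner ℝ w ((data r.draws).1 : Amb d) ≤ b) := h
    rw [if_neg h, if_neg (by rw [decide_eq_false h']; simp)]
    rfl

lemma rejectionSample_apply_of_mem {b : ℝ} {w : Amb d} {data : Data d} {r : Resources}
    (h : data r.draws ∈ labelledBand b w) :
    ∃ k ≤ 4 * d + 4, rejectionSample b (WithLp.ofLp w) data r =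
      some ((r.draws, WithLp.ofLp ((data r.draws).1 : Amb d),
        inner ℝ w ((data r.draws).1 : Amb d)), r.addDraw k) := by
  obtain ⟨k, hk, hbody⟩ := rejectionSample_body_apply b w data r
  rw [if_pos h] at hbody
  exact ⟨k, hk, repeatUntil_of_some hbody⟩

lemma rejectionSample_apply_of_notMem {b : ℝ} {w : Amb d} {data : Data d} {r : Resources}
    (h : data r.draws ∉ labelledBand b w) :
    ∃ k ≤ 4 * d + 4, rejectionSample b (WithLp.ofLp w) data r =
      rejectionSample b (WithLp.ofLp w) data (r.addDraw k) := by
  obtain ⟨k, hk, hbody⟩ := rejectionSample_body_apply b w data r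
  rw [if_neg h] at hbody
  exact ⟨k, hk, repeatUntil_of_none hbody⟩

lemma iteration_apply_of_mem {b : ℝ} {w : Amb d} {data : Data d} {r : Resources}
    (h : data r.draws ∈ labelledBand b w) :
    ∃ k ≤ 8 * d + 8, iteration b (WithLp.ofLp w) data r =
      some (WithLp.ofLp (update w (data r.draws)),
        ⟨r.draws + 1, r.labels + 1, r.time + k⟩) := by
  obtain ⟨k, hk, hR⟩ := rejectionSample_apply_of_mem h
  have hq : query r.draws data (r.addDraw k) = some (Label.val (data r.draws).2,
      ⟨r.draws + 1, r.labels + 1, r.time + k + 1⟩) := rfl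
  simp only [iteration, Prog.bind_apply, hR, Option.bind_some, hq, mul_apply, lt_apply, update]
  by_cases hlt : Label.val (data r.draws).2 * inner ℝ w ((data r.draws).1 : Amb d) < 0
  · refine ⟨k + 4 + 4 * d, by omega, ?_⟩
    rw [if_pos (decide_eq_true hlt), if_pos hlt]
    simp only [Prog.bind_apply, mul_apply, Option.bind_some, subScaled_apply]
    congr 2
    simp only [Resources.addTime]
    congr 1
    ring
  · refine ⟨k + 3, by omega, ?_⟩
    rw [if_neg (by simpa using hlt), if_neg hlt]
    rfl

/-- The chain appends draws at the end, whereas the program consumes the stream from the front; this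
form permits induction along the program. -/
lemma trajectory_succ' (b : ℝ) (s : Amb d × ℕ) (data : Data d) (n : ℕ) :
    trajectory b s data (n + 1) = trajectory b (next b s (data 0)) (fun i => data (i + 1)) n := by
  induction n with
  | zero => rfl
  | succ n ih => rw [trajectory, ih]; rfl

lemma trajectory_of_snd_eq_zero (b : ℝ) (w : Amb d) (data : Data d) (n : ℕ) :
    trajectory b (w, 0) data n = (w, 0) := by
  induction n with
  | zero => rfl
  | succ n ih => rw [trajectory, ih]; simp [next]

lemma modifiedPerceptron_succ_apply (b : ℝ) (j : ℕ) (w : Vec d) (data : Data d) (r : Resources) :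
    modifiedPerceptron b (j + 1) w data r = (iteration b w data (r.addTime 1)).bind
      fun p => modifiedPerceptron b j p.1 data p.2 := by
  simp only [modifiedPerceptron, Prog.bind_apply, step_apply, Option.bind_some]

/-- If the per-draw dynamics complete all iterations within `n` draws, then the procedure
terminates with the same vector, within the corresponding resources. -/
theorem modifiedPerceptron_apply_of_trajectory (b : ℝ) (data : Data d) (n j : ℕ) (w : Amb d)
    (r : Resources)
    (h : (trajectory b (w, j) (fun i => data (r.draws + i)) n).2 = 0) :
    ∃ r' : Resources, modifiedPerceptron b j (WithLp.ofLp w) data r =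
      some (WithLp.ofLp (trajectory b (w, j) (fun i => data (r.draws + i)) n).1, r') ∧
      r'.draws ≤ r.draws + n ∧ r'.labels = r.labels + j ∧
      r'.time ≤ r.time + n * (4 * d + 4) + j * (4 * d + 5) := by
  induction n generalizing j w r with
  | zero =>
    obtain rfl : j = 0 := h
    exact ⟨r, rfl, by simp, rfl, by simp⟩
  | succ n ih =>
    rcases j with _ | j
    · rw [trajectory_of_snd_eq_zero]
      exact ⟨r, rfl, by omega, rfl, by omega⟩
    · rw [trajectory_succ'] at h ⊢
      rw [add_zero] at h ⊢
      by_cases hz : data r.draws ∈ labelledBand b w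
      · have hn : next b (w, j + 1) (data r.draws) = (update w (data r.draws), j) := by
          simp only [next]; rw [if_pos ⟨by simp, hz⟩]; simp
        rw [hn] at h ⊢
        obtain ⟨k, hk, hI⟩ := iteration_apply_of_mem (r := r.addTime 1) hz
        have hd : (r.addTime 1).draws = r.draws := rfl
        rw [hd] at hI
        have hshift : (fun i => data (r.draws + (i + 1))) = fun i => data (r.draws + 1 + i) := by
          funext i; congr 1; ring
        rw [hshift] at h ⊢
        obtain ⟨r', h1, h2, h3, h4⟩ := ih j (update w (data r.draws))
          ⟨r.draws + 1, r.labels + 1, r.time + 1 + k⟩ h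
        refine ⟨r', ?_, by simp only at h2; omega, by simp only at h3; omega, ?_⟩
        · rw [modifiedPerceptron_succ_apply, hI]
          exact h1
        · simp only at h4
          -- An accepting iteration costs at most `8 d + 8` steps and the loop one more, split as `4
          -- d + 4` for the draw and `4 d + 5` for the iteration.
          have : (n + 1) * (4 * d + 4) + (j + 1) * (4 * d + 5) =
            n * (4 * d + 4) + j * (4 * d + 5) + (8 * d + 9) := by ring
          omega
      · have hn : next b (w, j + 1) (data r.draws) = (w, j + 1) := by
          simp only [next]; rw [if_neg fun h => hz h.2]
        rw [hn] at h ⊢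
        obtain ⟨k, hk, hI⟩ := rejectionSample_apply_of_notMem (r := r.addTime 1) hz
        have hshift : (fun i => data (r.draws + (i + 1))) = fun i => data (r.draws + 1 + i) := by
          funext i; congr 1; ring
        rw [hshift] at h ⊢
        obtain ⟨r', h1, h2, h3, h4⟩ := ih (j + 1) w (r.addDraw k) h
        refine ⟨r', ?_, ?_, h3, ?_⟩
        · rw [modifiedPerceptron_succ_apply] at h1 ⊢
          -- The loop step may equally be charged after the rejected draw, so the run continues like
          -- a fresh one from `r.addDraw k`.
          refine Eq.trans ?_ h1
          congr 1
          simp only [iteration, Prog.bind_apply, hI]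
          congr 2
          simp only [Resources.addTime, Resources.addDraw]
          congr 1
          ring
        · simp only [Resources.addDraw] at h2; omega
        · simp only [Resources.addDraw] at h4
          have : (n + 1) * (4 * d + 4) = n * (4 * d + 4) + (4 * d + 4) := by ring
          omega

end Program

/-! ### Choice of the parameters and numerical estimates. -/

lemma one_sub_cos_bounds {θ : ℝ} (h0 : 0 < θ) (h1 : θ ≤ Real.pi / 2) :
    θ ^ 2 / 5 ≤ 1 - Real.cos θ ∧ 1 - Real.cos θ ≤ θ ^ 2 / 2 ∧ 1 - Real.cos θ ≤ 1 := by
  have hpi := Real.pi_pos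
  refine ⟨?_, ?_, ?_⟩
  · have h2 := Real.cos_le_one_sub_mul_cos_sq (x := θ) (by rw [abs_of_pos h0]; linarith)
    have h3 : θ ^ 2 / 5 ≤ 2 / Real.pi ^ 2 * θ ^ 2 := by
      rw [div_mul_eq_mul_div, div_le_div_iff₀ (by norm_num) (by positivity)]
      have h4 : Real.pi ^ 2 ≤ 10 := by
        have := Real.pi_lt_d2
        nlinarith
      nlinarith [mul_le_mul_of_nonneg_left h4 (sq_nonneg θ)]
    linarith
  · have := Real.one_sub_sq_div_two_le_cos (x := θ)
    linarith
  · have := Real.cos_nonneg_of_mem_Icc (x := θ) ⟨by linarith, h1⟩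
    linarith

lemma norm_sub_sq_eq_two_mul_gap {d : ℕ} {u w : Amb d} (hu : ‖u‖ = 1) (hw : ‖w‖ = 1) :
    ‖u - w‖ ^ 2 = 2 * gap u w := by
  rw [norm_sub_sq_real, hu, hw, real_inner_comm, gap]
  ring

section Parameters

variable {d : ℕ} {D : Measure (Example d)} [IsProbabilityMeasure D] {u : Instance d}
  {b g : ℝ}

/-- Below `3 g² / 2` the distance from `w` to `u` is at most `2 g`, so `|u ⬝ x| ≤ b + 2 g` in the
band and the gap changes by at most `6 b g`. -/
lemma lam_mul_abs_gap_update_sub_le (hg : 0 < g) (hb : 0 < b) (hbg : b ≤ g) {w : Amb d}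
    (hw : ‖w‖ = 1) (hgap : gap u w ≤ 3 * g ^ 2 / 2) {z : Example d} (hz : z ∈ labelledBand b w) :
    1 / (200 * b * g) * |gap u (update w z) - gap (u : Amb d) w| ≤ 1 := by
  have h1 := abs_gap_update_sub_le hb u w hz
  have hu : ‖(u : Amb d)‖ = 1 := by simp
  have hx : ‖(z.1 : Amb d)‖ = 1 := by simp
  have h2 := norm_sub_sq_eq_two_mul_gap hu hw
  have h3 : ‖(u : Amb d) - w‖ ≤ 2 * g := by
    rw [← sq_le_sq₀ (norm_nonneg _) (by positivity), h2]
    nlinarith [sq_nonneg g]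
  have h4 : |inner ℝ (u : Amb d) (z.1 : Amb d)| ≤ 3 * g := by
    have e : inner ℝ (u : Amb d) (z.1 : Amb d) = inner ℝ w (z.1 : Amb d) +
        inner ℝ ((u : Amb d) - w) (z.1 : Amb d) := by rw [inner_sub_left]; ring
    have h5 : |inner ℝ ((u : Amb d) - w) (z.1 : Amb d)| ≤ 2 * g := by
      refine (abs_real_inner_le_norm _ _).trans ?_
      rwa [hx, mul_one]
    have h6 : |inner ℝ w (z.1 : Amb d)| ≤ b := by
      obtain ⟨h7, h8⟩ := hz
      rw [abs_of_nonneg (by linarith)]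
      exact h8
    rw [e]
    exact (abs_add_le _ _).trans (by linarith)
  rw [div_mul_eq_mul_div, one_mul, div_le_one (by positivity)]
  have h9 := mul_le_mul_of_nonneg_left h4 (by positivity : 0 ≤ 2 * b)
  have : 0 < b * g := by positivity
  linarith

lemma setIntegral_exp_gap_update_sub_le_of_gap_mem (hd : 3 ≤ d)
    (hD : D.map Prod.fst = uniformSphere d) (hg : 0 < g) (hg1 : g ≤ 1) (hb : 0 < b)
    (hbg : b * √(d : ℝ) ≤ g / 4000) {w : Amb d} (hw : ‖w‖ = 1) (hlo : g ^ 2 / 8 ≤ gap u w)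
    (hhi : gap u w ≤ 3 * g ^ 2 / 2)
    (hN : D.real (noiseSet u) ≤ (uniformSphere d).real (band b w) / 4000) :
    ∫ z in labelledBand b w,
      Real.exp (1 / (200 * b * g) * (gap u (update w z) - gap (u : Amb d) w)) ∂D ≤
      (1 - 1 / (12800 * √(d : ℝ))) * D.real (labelledBand b w) := by
  have hd3 : (3 : ℝ) ≤ d := by exact_mod_cast hd
  have hs0 : 0 < √(d : ℝ) := Real.sqrt_pos.2 (by linarith)
  have hs1 : 1 ≤ √(d : ℝ) := Real.one_le_sqrt.2 (by linarith)
  have hr0 : 0 < √((d : ℝ) - 1) := Real.sqrt_pos.2 (by linarith)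
  have hr2 : √((d : ℝ) - 1) ^ 2 = d - 1 := Real.sq_sqrt (by linarith)
  have hrs : √((d : ℝ) - 1) ≤ √(d : ℝ) := Real.sqrt_le_sqrt (by linarith)
  have hinner : inner ℝ w (u : Amb d) = 1 - gap (u : Amb d) w := by rw [gap]; ring
  set φ := gap (u : Amb d) w with hφ
  have hg2 : g ^ 2 ≤ 1 := pow_le_one₀ hg.le hg1
  have hg0 : 0 < g ^ 2 := by positivity
  have hpos : 0 ≤ 1 - inner ℝ w (u : Amb d) ^ 2 := by
    rw [hinner]; nlinarith
  set a := √(1 - inner ℝ w (u : Amb d) ^ 2) with ha_def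
  have ha2 : a ^ 2 = 1 - inner ℝ w (u : Amb d) ^ 2 := Real.sq_sqrt hpos
  have ha2' : a ^ 2 = φ * (2 - φ) := by rw [ha2, hinner]; ring
  -- Here `a² = φ (2 - φ)` with `φ ≥ g² / 8` and `2 - φ ≥ 1 / 2`.
  have ha_lo : g / 4 ≤ a := by
    refine Real.le_sqrt_of_sq_le ?_
    rw [hinner]; nlinarith
  have ha0 : 0 < a := by linarith
  have ha_hi : a ^ 2 ≤ 3 * g ^ 2 := by rw [ha2']; nlinarith
  have hbr : b ≤ a / √((d : ℝ) - 1) / 1000 := by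
    rw [div_div, le_div_iff₀ (by positivity)]
    have := mul_le_mul_of_nonneg_left hrs hb.le
    linarith
  have hy : 1 / (200 * b * g) * (b * (a / √((d : ℝ) - 1))) = a / (200 * g * √((d : ℝ) - 1)) := by
    field_simp
  have hmain := setIntegral_exp_gap_update_sub_le (D := D) (u := u) (w := w)
    (p := (uniformSphere d).real (band b w)) (by omega : 2 ≤ d) hD hw ha0
    ha2 hb hbr rfl hN (by positivity : 0 ≤ 1 / (200 * b * g))
    (fun z hz => lam_mul_abs_gap_update_sub_le hg hb (by nlinarith) hw hhi hz) ?_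
  · rw [measureReal_def, measure_labelledBand hD, ← measureReal_def]
    refine hmain.trans (mul_le_mul_of_nonneg_right ?_ measureReal_nonneg)
    rw [hy]
    have h1 : 1 / (12800 * √(d : ℝ)) ≤ a / (200 * g * √((d : ℝ) - 1)) / 16 := by
      rw [div_div, div_le_div_iff₀ (by positivity) (by positivity)]
      have h2 := mul_le_mul_of_nonneg_left hrs hg.le
      have h3 := mul_le_mul_of_nonneg_right ha_lo hs0.le
      linarith
    linarith
  · rw [hy, mul_div_assoc', div_le_one (by positivity)]
    -- This is `144 a ≤ 200 g √(d - 1)` divided by 8 and squared; `324 · 3 ≤ 625 (d - 1)` holds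
    -- because `d ≥ 3`.
    have h1 : (18 * a) ^ 2 ≤ (25 * (g * √((d : ℝ) - 1))) ^ 2 := by
      rw [mul_pow, mul_pow, mul_pow, hr2]
      nlinarith
    have h2 := (sq_le_sq₀ (by positivity) (by positivity)).1 h1
    linarith

/-- The success of the per-draw dynamics, with the potential instantiated. -/
theorem le_measure_trajectory_success_of_parameters (hd : 3 ≤ d)
    (hD : D.map Prod.fst = uniformSphere d) (hg : 0 < g) (hg1 : g ≤ 1) (hb : 0 < b)
    (hbg : b * √(d : ℝ) ≤ g / 4000) (hN : D.real (noiseSet u) ≤ b * √(d : ℝ) / 30 / 4000)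
    {Ω : Type*} [MeasurableSpace Ω] {P : Measure Ω} [IsProbabilityMeasure P]
    {Z : ℕ → Ω → Example d} (hZ : ∀ i, Measurable (Z i)) (hlaw : ∀ i, P.map (Z i) = D)
    (hind : iIndepFun Z P) {w₀ : Amb d} (hw₀ : ‖w₀‖ = 1) (n m : ℕ) {δ : ℝ}
    (hδ : potential u (1 / (200 * b * g)) (1 - 1 / (12800 * √(d : ℝ))) (g ^ 2)
      (2 * Real.exp (1 - 1 / (200 * b * g) * g ^ 2 / 8)) (w₀, m) +
      budgetBound (1 - b * √(d : ℝ) / 30 / 2) n m ≤ δ) :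
    ∃ E : Set Ω, MeasurableSet E ∧ ENNReal.ofReal (1 - δ) ≤ P E ∧
      ∀ ω ∈ E, (trajectory b (w₀, m) (fun i => Z i ω) n).2 = 0 ∧
        gap (u : Amb d) (trajectory b (w₀, m) (fun i => Z i ω) n).1 ≤ g ^ 2 / 4 := by
  have hd3 : (3 : ℝ) ≤ d := by exact_mod_cast hd
  have hs1 : 1 ≤ √(d : ℝ) := Real.one_le_sqrt.2 (by linarith)
  have hbs : 0 < b * √(d : ℝ) := by positivity
  have hdb : d * b ^ 2 ≤ 1 / 100 := by
    have : d * b ^ 2 = (b * √(d : ℝ)) ^ 2 := by rw [mul_pow, Real.sq_sqrt (by linarith)]; ring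
    rw [this]
    nlinarith
  have hband : ∀ w : Amb d, ‖w‖ = 1 →
      b * √(d : ℝ) / 30 ≤ (uniformSphere d).real (band b w) := fun w hw =>
    le_uniformSphere_band hd hb hdb hw
  have hρ : 1 / (12800 * √(d : ℝ)) ≤ 1 := by
    rw [div_le_one (by positivity)]; linarith
  have hρ0 : 0 ≤ 1 / (12800 * √(d : ℝ)) := by positivity
  have hlam : 0 ≤ 1 / (200 * b * g) := by positivity
  refine le_measure_trajectory_success (D := D) (u := (u : Amb d)) (b := b)
    (lam := 1 / (200 * b * g)) (ρ := 1 - 1 / (12800 * √(d : ℝ))) (G := g ^ 2)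
    (κ := 2 * Real.exp (1 - 1 / (200 * b * g) * g ^ 2 / 8)) (p₀ := b * √(d : ℝ) / 30) (s := (w₀, m))
    hlam (by linarith) (by linarith) le_rfl ?_ ?_ (by linarith)
    (by linarith) ?_ hZ hlaw hind hw₀ n hδ
  · intro w hw h1 h2
    exact setIntegral_exp_gap_update_sub_le_of_gap_mem hd hD hg hg1 hb hbg hw h1 h2
      (hN.trans (by linarith [hband w hw]))
  · intro w hw h1 z hz
    exact lam_mul_abs_gap_update_sub_le hg hb (by nlinarith) hw h1 hz
  · intro w hw
    rw [measureReal_def, measure_labelledBand hD, ← measureReal_def]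
    exact hband w hw

end Parameters

/-- Numerical facts on the number of iterations `m = ⌈K d log (K d / δ)⌉`. -/
lemma iteration_count_bounds {K d δ : ℝ} (hK : 1000000000000 ≤ K) (hd : 3 ≤ d) (hδ0 : 0 < δ)
    (hδ1 : δ < 1) {m : ℕ} (hm : m = ⌈K * d * Real.log (K * d / δ)⌉₊) :
    1 ≤ Real.log (K * d / δ) ∧ 1000000000000 ≤ (m : ℝ) ∧ K * d * Real.log (K * d / δ) ≤ m ∧
      (m : ℝ) ≤ 2 * (K * d * Real.log (K * d / δ)) ∧ 1 ≤ Real.log ((m : ℝ) ^ 2 / δ) ∧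
      Real.log ((m : ℝ) ^ 2 / δ) ≤ 6 * Real.log (K * d / δ) := by
  set X := K * d / δ with hX
  have hKd : 1000000000000 ≤ K * d := by nlinarith
  have hXKd : K * d ≤ X := by
    rw [hX, le_div_iff₀ hδ0]
    nlinarith
  have hX0 : 0 < X := by linarith
  have hδX : 1 / δ ≤ X := by
    rw [hX]
    exact div_le_div_of_nonneg_right (by linarith) hδ0.le
  have hl1 : 1 ≤ Real.log X := by
    rw [Real.le_log_iff_exp_le hX0]
    linarith [Real.exp_one_lt_d9]
  have hlX : Real.log X ≤ X := (Real.log_le_sub_one_of_pos hX0).trans (by linarith)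
  have hpos : 1000000000000 ≤ K * d * Real.log X := by nlinarith
  have hm1 : K * d * Real.log X ≤ m := hm ▸ Nat.le_ceil _
  have hm2 : (m : ℝ) ≤ 2 * (K * d * Real.log X) := by
    have := (Nat.ceil_lt_add_one (by linarith : 0 ≤ K * d * Real.log X)).le
    rw [← hm] at this
    linarith
  have hm3 : 1000000000000 ≤ (m : ℝ) := hpos.trans hm1
  have hm0 : (0 : ℝ) < m := by linarith
  refine ⟨hl1, hm3, hm1, hm2, ?_, ?_⟩
  · rw [Real.le_log_iff_exp_le (by positivity), le_div_iff₀ hδ0]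
    have := Real.exp_one_lt_d9
    nlinarith
  · have h6 : 6 * Real.log X = Real.log (X ^ 6) := by rw [Real.log_pow]; norm_num
    rw [h6]
    refine Real.log_le_log (by positivity) ?_
    have hmX : (m : ℝ) ≤ 2 * X ^ 2 := by
      refine hm2.trans ?_
      have : K * d * Real.log X ≤ X * X := mul_le_mul hXKd hlX (by linarith) hX0.le
      linarith
    have h4 : (m : ℝ) ^ 2 ≤ (2 * X ^ 2) ^ 2 := pow_le_pow_left₀ hm0.le hmX 2
    calc (m : ℝ) ^ 2 / δ = (m : ℝ) ^ 2 * (1 / δ) := by ring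
      _ ≤ (2 * X ^ 2) ^ 2 * X := mul_le_mul h4 hδX (by positivity) (by positivity)
      _ = 4 * X ^ 5 := by ring
      _ ≤ X * X ^ 5 := mul_le_mul_of_nonneg_right (by linarith) (by positivity)
      _ = X ^ 6 := by ring

lemma budgetBound_le_exp_neg {p : ℝ} (hp0 : 0 < p) (hp1 : p ≤ 1) {n m : ℕ}
    (hn : 4 * m / p ≤ n) : budgetBound (1 - p / 2) n m ≤ Real.exp (-m) := by
  have h1 : (1 - p / 2) ^ n ≤ Real.exp (-(2 * m)) := by
    have h2 : 1 - p / 2 ≤ Real.exp (-(p / 2)) := Real.one_sub_le_exp_neg _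
    refine (pow_le_pow_left₀ (by linarith) h2 n).trans ?_
    rw [← Real.exp_nat_mul, Real.exp_le_exp]
    rw [div_le_iff₀ hp0] at hn
    linarith
  have h3 : (2 : ℝ) ^ m - 1 ≤ Real.exp m := by
    have h4 : (2 : ℝ) ^ m ≤ Real.exp 1 ^ m :=
      pow_le_pow_left₀ (by norm_num) (by linarith [Real.add_one_le_exp (1 : ℝ)]) m
    rw [← Real.exp_nat_mul, mul_one] at h4
    linarith
  refine (mul_le_mul h3 h1 (pow_nonneg (by linarith) n) (Real.exp_pos _).le).trans_eq ?_
  rw [← Real.exp_add]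
  congr 1
  ring

/-- The three terms of the potential and the budget term are each at most `δ / 10`. -/
lemma potential_add_budgetBound_le {d : ℕ} (hd : 3 ≤ d) {K δ θ c L g : ℝ}
    (hK : 1000000000000 ≤ K) (hδ0 : 0 < δ) (hδ1 : δ < 1) (hθ : 0 < θ) (hc1 : 3500000 ≤ c ^ 2)
    (hc2 : c ^ 2 ≤ 3600000) (hg : 0 < g) (hg1 : θ ^ 2 / 5 ≤ g ^ 2) (hg2 : g ^ 2 ≤ θ ^ 2 / 2)
    {m n : ℕ} (hm : m = ⌈K * d * Real.log (K * d / δ)⌉₊) (hL : L = Real.log ((m : ℝ) ^ 2 / δ))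
    {b : ℝ} (hb : b = 1 / (2 * c ^ 2 * L) * (θ / √(d : ℝ))) (hp1 : b * √(d : ℝ) / 30 ≤ 1)
    (hn : 4 * m / (b * √(d : ℝ) / 30) ≤ n) {u w : Amb d} (hgap : gap u w ≤ g ^ 2) :
    potential u (1 / (200 * b * g)) (1 - 1 / (12800 * √(d : ℝ))) (g ^ 2)
      (2 * Real.exp (1 - 1 / (200 * b * g) * g ^ 2 / 8)) (w, m) +
      budgetBound (1 - b * √(d : ℝ) / 30 / 2) n m ≤ δ := by
  have hd3 : (3 : ℝ) ≤ d := by exact_mod_cast hd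
  obtain ⟨hl1, hm0, hm1, hm2, hL1, hL6⟩ := iteration_count_bounds hK hd3 hδ0 hδ1 hm
  rw [← hL] at hL1 hL6
  set X := K * d / δ with hX
  have hX0 : 0 < X := by positivity
  have hKd : 1000000000000 ≤ K * d := by nlinarith
  have hs0 : 0 < √(d : ℝ) := Real.sqrt_pos.2 (by linarith)
  have hs1 : 1 ≤ √(d : ℝ) := Real.one_le_sqrt.2 (by linarith)
  have hs2 : √(d : ℝ) * √(d : ℝ) = d := Real.mul_self_sqrt (by linarith)
  have hL0 : 0 < L := by linarith
  have hc0 : 0 < c ^ 2 := by linarith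
  have hb0 : 0 < b := by rw [hb]; positivity
  have hexpl : Real.exp (-Real.log X) ≤ δ / 10 := by
    rw [Real.exp_neg, Real.exp_log hX0, hX, inv_div]
    exact div_le_div_of_nonneg_left hδ0.le (by norm_num) (by linarith)
  have hexpL : Real.exp (-L) = δ / (m : ℝ) ^ 2 := by
    rw [hL, Real.exp_neg, Real.exp_log (by positivity), inv_div]
  have hgθ1 : 2 / 5 * θ ≤ g := by
    rw [← sq_le_sq₀ (by positivity) hg.le]; nlinarith
  have hgθ2 : g ≤ θ := by
    rw [← sq_le_sq₀ hg.le hθ.le]; nlinarith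
  set lam := 1 / (200 * b * g) with hlam
  have hlam0 : 0 < lam := by positivity
  -- This exponent has order `L √d`. Its lower bound in terms of `L` makes the escape and low-gap
  -- terms small; its upper bound in terms of `√d log X` says how much contraction the first term
  -- needs.
  have hΛ : lam * g ^ 2 = g / θ * (c ^ 2 * (L * √(d : ℝ)) / 100) := by
    rw [hlam, hb]; field_simp; ring
  have hΛ1 : 10000 * L ≤ lam * g ^ 2 := by
    rw [hΛ]
    have h1 : 2 / 5 ≤ g / θ := (le_div_iff₀ hθ).2 hgθ1
    have h2 : L ≤ L * √(d : ℝ) := le_mul_of_one_le_right hL0.le hs1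
    have h3 : 3500000 * L / 100 ≤ c ^ 2 * (L * √(d : ℝ)) / 100 := by
      apply div_le_div_of_nonneg_right _ (by norm_num)
      exact mul_le_mul hc1 h2 hL0.le hc0.le
    have h4 := mul_le_mul h1 h3 (by positivity) (by positivity)
    linarith
  have hΛ2 : lam * g ^ 2 ≤ 216000 * (√(d : ℝ) * Real.log X) := by
    rw [hΛ]
    have h1 : g / θ ≤ 1 := (div_le_one hθ).2 hgθ2
    have h2 : L * √(d : ℝ) ≤ 6 * Real.log X * √(d : ℝ) := mul_le_mul_of_nonneg_right hL6 hs0.le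
    have h3 : c ^ 2 * (L * √(d : ℝ)) ≤ 3600000 * (6 * Real.log X * √(d : ℝ)) :=
      mul_le_mul hc2 h2 (by positivity) (by norm_num)
    have h4 := mul_le_of_le_one_left (by positivity : 0 ≤ c ^ 2 * (L * √(d : ℝ)) / 100) h1
    linarith
  have t1 : (1 - 1 / (12800 * √(d : ℝ))) ^ m * Real.exp (lam * (gap u w - g ^ 2 / 4)) ≤
      δ / 10 := by
    have hρ0 : 0 ≤ 1 - 1 / (12800 * √(d : ℝ)) := by
      rw [sub_nonneg, div_le_one (by positivity)]; linarith
    have h1 := pow_le_pow_left₀ hρ0 (Real.one_sub_le_exp_neg (1 / (12800 * √(d : ℝ)))) m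
    rw [← Real.exp_nat_mul] at h1
    refine (mul_le_mul_of_nonneg_right h1 (Real.exp_pos _).le).trans (le_trans ?_ hexpl)
    rw [← Real.exp_add, Real.exp_le_exp]
    have h2 : lam * (gap u w - g ^ 2 / 4) ≤ 216000 * (√(d : ℝ) * Real.log X) := by
      refine le_trans (mul_le_mul_of_nonneg_left ?_ hlam0.le) hΛ2
      linarith [sq_nonneg g]
    -- As `m` is at least `10 ^ 12 d log X`, the `m` contractions at rate `1 / √d` yield an exponent
    -- of order `√d log X` that outweighs the initial one.
    have h3 : 1000000 * (√(d : ℝ) * Real.log X) ≤ m * (1 / (12800 * √(d : ℝ))) := by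
      rw [mul_one_div, le_div_iff₀ (by positivity)]
      have h4 : 1000000 * (√(d : ℝ) * Real.log X) * (12800 * √(d : ℝ)) =
        12800000000 * (√(d : ℝ) * √(d : ℝ) * Real.log X) := by ring
      have h5 : 0 ≤ d * Real.log X := by positivity
      rw [h4, hs2]
      refine le_trans ?_ hm1
      have := mul_le_mul_of_nonneg_right hK h5
      linarith
    have h6 : Real.log X ≤ √(d : ℝ) * Real.log X := le_mul_of_one_le_left (by linarith) hs1
    have h7 : (m : ℝ) * -(1 / (12800 * √(d : ℝ))) = -(m * (1 / (12800 * √(d : ℝ)))) := by ring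
    rw [h7]
    linarith
  have t2 : Real.exp (lam * (gap u w - 3 * g ^ 2 / 2)) ≤ δ / 10 := by
    have h1 : Real.exp (lam * (gap u w - 3 * g ^ 2 / 2)) ≤ Real.exp (-L) := by
      rw [Real.exp_le_exp]
      have := mul_le_mul_of_nonneg_left hgap hlam0.le
      linarith
    rw [hexpL] at h1
    refine h1.trans (div_le_div_of_nonneg_left hδ0.le (by norm_num) ?_)
    exact (by linarith : 10 ≤ (m : ℝ)).trans (le_self_pow₀ (by linarith) (by norm_num))
  have t3 : m * (2 * Real.exp (1 - lam * g ^ 2 / 8)) ≤ δ / 10 := by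
    have h1 : Real.exp (1 - lam * g ^ 2 / 8) ≤ Real.exp (-L) := by
      rw [Real.exp_le_exp]
      linarith
    rw [hexpL] at h1
    have h2 : (m : ℝ) * (2 * (δ / (m : ℝ) ^ 2)) = 2 * δ / m := by field_simp
    refine (mul_le_mul_of_nonneg_left (mul_le_mul_of_nonneg_left h1 (by norm_num))
      (by linarith)).trans ?_
    rw [h2, div_le_div_iff₀ (by linarith) (by norm_num)]
    have := mul_le_mul_of_nonneg_left hm0 hδ0.le
    linarith
  have t4 : budgetBound (1 - b * √(d : ℝ) / 30 / 2) n m ≤ δ / 10 := by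
    refine (budgetBound_le_exp_neg (by positivity) hp1 hn).trans (le_trans ?_ hexpl)
    rw [Real.exp_le_exp, neg_le_neg_iff]
    exact (le_mul_of_one_le_left (by linarith) (by linarith)).trans hm1
  simp only [potential]
  linarith

/-- With `y = cos (θ / 2)`, the double-angle formula gives `(1 - cos θ) / 4 = (1 - y) (1 + y) / 2 ≤
1 - y`. -/
lemma angle_le_half_of_gap_le {d : ℕ} {u w : Amb d} (hu : ‖u‖ = 1) (hw : ‖w‖ = 1) {θ : ℝ}
    (hθ0 : 0 < θ) (hθ : θ ≤ Real.pi / 2) (h : gap u w ≤ (1 - Real.cos θ) / 4) :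
    InnerProductGeometry.angle w u ≤ θ / 2 := by
  have hpi := Real.pi_pos
  rw [InnerProductGeometry.angle, hu, hw, mul_one, div_one]
  have hc0 := Real.cos_nonneg_of_mem_Icc (x := θ / 2) ⟨by linarith, by linarith⟩
  have hc1 := Real.cos_le_one (θ / 2)
  have h2 : Real.cos θ = 2 * Real.cos (θ / 2) ^ 2 - 1 := by
    rw [← Real.cos_two_mul]; congr 1; ring
  have h3 : Real.cos (θ / 2) ≤ inner ℝ w u := by
    rw [gap, h2] at h
    nlinarith
  refine (Real.arccos_le_arccos h3).trans_eq ?_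
  exact Real.arccos_cos (by linarith) (by linarith)

lemma gap_le_of_angle_le {d : ℕ} {u w : Amb d} (hu : ‖u‖ = 1) (hw : ‖w‖ = 1) {θ : ℝ}
    (hθ : θ ≤ Real.pi / 2) (h : InnerProductGeometry.angle w u ≤ θ) :
    gap u w ≤ 1 - Real.cos θ := by
  have h1 := Real.cos_le_cos_of_nonneg_of_le_pi (InnerProductGeometry.angle_nonneg w u)
    (by linarith [Real.pi_pos]) h
  rw [InnerProductGeometry.cos_angle, hu, hw, mul_one, div_one] at h1
  rw [gap]
  linarith

lemma sq_six_hundred_pi_bounds :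
    3500000 ≤ (600 * Real.pi) ^ 2 ∧ (600 * Real.pi) ^ 2 ≤ 3600000 := by
  have h1 := Real.pi_gt_d2
  have h2 := Real.pi_lt_d2
  constructor <;> nlinarith

lemma le_cube_pi : 1000000000000 ≤ (3200 * Real.pi) ^ 3 := by
  have h1 := Real.pi_gt_d2
  have : (10000 : ℝ) ^ 3 ≤ (3200 * Real.pi) ^ 3 :=
    pow_le_pow_left₀ (by norm_num) (by linarith) 3
  linarith

/-- The resource bounds, with `κ = log K + 1`. -/
lemma resource_bounds {K d δ θ c L κ : ℝ} (hK : 1000000000000 ≤ K) (hd : 3 ≤ d) (hδ0 : 0 < δ)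
    (hδ1 : δ < 1) (hθ : 0 < θ) (hc1 : 3500000 ≤ c ^ 2) {m n : ℕ} (hκ : κ = Real.log K + 1)
    (hm : m = ⌈K * d * Real.log (K * d / δ)⌉₊) (hL : L = Real.log ((m : ℝ) ^ 2 / δ))
    {p : ℝ} (hp : p = θ / (60 * c ^ 2 * L)) (hp1 : p ≤ 1) (hn : n = ⌈4 * m / p⌉₊) :
    (m : ℝ) ≤ 43200 * c ^ 2 * K * κ ^ 2 * (d * (Real.log d + Real.log (1 / δ))) ∧
    (m : ℝ) ≤ n ∧
    12 * (n : ℝ) ≤ 43200 * c ^ 2 * K * κ ^ 2 *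
      (d * (Real.log d + Real.log (1 / δ)) ^ 2 * (1 / θ)) := by
  obtain ⟨hl1, hm0, hm1, hm2, hL1, hL6⟩ := iteration_count_bounds hK hd hδ0 hδ1 hm
  rw [← hL] at hL1 hL6
  have hlK : 0 ≤ Real.log K := Real.log_nonneg (by linarith)
  have hκ1 : 1 ≤ κ := by linarith
  have hld : 1 ≤ Real.log d := by
    rw [Real.le_log_iff_exp_le (by linarith)]
    linarith [Real.exp_one_lt_d9]
  have hlδ : 0 ≤ Real.log (1 / δ) := Real.log_nonneg (by rw [le_div_iff₀ hδ0]; linarith)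
  set ℓ := Real.log d + Real.log (1 / δ) with hℓ
  have hℓ1 : 1 ≤ ℓ := by linarith
  have hlog : Real.log (K * d / δ) ≤ κ * ℓ := by
    have e : Real.log (K * d / δ) = Real.log K + ℓ := by
      rw [hℓ, div_eq_mul_one_div, Real.log_mul (by positivity) (by positivity),
        Real.log_mul (by positivity) (by positivity)]
      ring
    -- Since `d ≥ 3` forces `ℓ ≥ 1`, the constant `log K` is absorbed into the factor `κ`.
    rw [e, hκ]
    nlinarith
  have hm3 : (m : ℝ) ≤ 2 * K * κ * (d * ℓ) := by
    refine hm2.trans ?_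
    have := mul_le_mul_of_nonneg_left hlog (by positivity : 0 ≤ K * d)
    linarith
  have hp0 : 0 < p := by rw [hp]; positivity
  have hn1 : 4 * m / p ≤ n := hn ▸ Nat.le_ceil _
  have hmp : (m : ℝ) ≤ m / p := by
    rw [le_div_iff₀ hp0]
    exact mul_le_of_le_one_right (by linarith) hp1
  have hn2 : (n : ℝ) ≤ 5 * (m / p) := by
    have := (Nat.ceil_lt_add_one (by positivity : 0 ≤ 4 * m / p)).le
    rw [← hn] at this
    have e : 4 * (m : ℝ) / p = 4 * (m / p) := by ring
    linarith
  refine ⟨hm3.trans (mul_le_mul_of_nonneg_right ?_ (by positivity)), ?_, ?_⟩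
  · have h1 : 1 ≤ c ^ 2 * κ := by nlinarith
    have h2 := mul_le_mul_of_nonneg_left h1 (by positivity : 0 ≤ K * κ)
    have h3 : 0 < K * κ := by positivity
    have h4 : 43200 * c ^ 2 * K * κ ^ 2 = 43200 * (K * κ * (c ^ 2 * κ)) := by ring
    rw [h4]
    linarith
  · refine hmp.trans (le_trans ?_ hn1)
    exact div_le_div_of_nonneg_right (by linarith) hp0.le
  · have h1 : (m : ℝ) / p = m * (60 * c ^ 2 * L) * (1 / θ) := by
      rw [hp]; field_simp
    have h2 : L ≤ 6 * (κ * ℓ) := by linarith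
    have h3 : (m : ℝ) * (60 * c ^ 2 * L) ≤ 2 * K * κ * (d * ℓ) * (60 * c ^ 2 * (6 * (κ * ℓ))) := by
      refine mul_le_mul hm3 ?_ (by positivity) (by positivity)
      exact mul_le_mul_of_nonneg_left h2 (by positivity)
    have h4 := mul_le_mul_of_nonneg_right h3 (by positivity : 0 ≤ 1 / θ)
    rw [h1] at hn2
    refine (mul_le_mul_of_nonneg_left (hn2.trans (mul_le_mul_of_nonneg_left h4 (by norm_num)))
      (by norm_num)).trans_eq ?_
    ring

end ActivePerceptron

end

/-! ### Assembly of the main theorem. -/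

theorem mainTheorem5 :
    ∃ C : ℝ, 0 < C ∧
      ∀ (d : ℕ), 3 ≤ d →
      -- the law of the labelled examples, with uniform marginal on the sphere
      ∀ (D : Measure (ActivePerceptron.Example d)),
        D.map Prod.fst = ActivePerceptron.uniformSphere d →
      ∀ (u w₀ : ActivePerceptron.Instance d) (θ δ ν b : ℝ) (m : ℕ),
        0 < θ → θ ≤ Real.pi / 2 →
        InnerProductGeometry.angle (w₀ : EuclideanSpace ℝ (Fin d)) u ≤ θ →
        0 < δ → δ < 1 →
        m = ⌈(3200 * Real.pi) ^ 3 * d * Real.log ((3200 * Real.pi) ^ 3 * d / δ)⌉₊ →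
        b = 1 / (2 * (600 * Real.pi) ^ 2 * Real.log ((m : ℝ) ^ 2 / δ)) * (θ / √(d : ℝ)) →
        ActivePerceptron.AdversarialNoise D u ν →
        ν ≤ θ / (384 * (600 * Real.pi) ^ 4 * Real.log ((m : ℝ) ^ 2 / δ)) →
      -- the stream of i.i.d. examples
      ∀ (Ω : Type*) [MeasurableSpace Ω] (P : Measure Ω) [IsProbabilityMeasure P]
        (Z : ℕ → Ω → ActivePerceptron.Example d),
        (∀ i, Measurable (Z i)) → (∀ i, P.map (Z i) = D) → iIndepFun Z P →
      ∃ E : Set Ω, MeasurableSet E ∧ ENNReal.ofReal (1 - δ) ≤ P E ∧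
        ∀ ω ∈ E, ∃ (w : EuclideanSpace ℝ (Fin d)) (r : ActivePerceptron.Resources),
          ActivePerceptron.Runs m b w₀ (fun i => Z i ω) w r ∧
          InnerProductGeometry.angle w (u : EuclideanSpace ℝ (Fin d)) ≤ θ / 2 ∧
          (r.labels : ℝ) ≤ C * (d * (Real.log d + Real.log (1 / δ))) ∧
          (r.draws : ℝ) ≤ C * (d * (Real.log d + Real.log (1 / δ)) ^ 2 * (1 / θ)) ∧
          (r.time : ℝ) ≤ C * ((d : ℝ) ^ 2 * (Real.log d + Real.log (1 / δ)) ^ 2 * (1 / θ)) := by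
  obtain ⟨hc1, hc2⟩ := ActivePerceptron.sq_six_hundred_pi_bounds
  have hK := ActivePerceptron.le_cube_pi
  set c := 600 * Real.pi
  set K := (3200 * Real.pi) ^ 3
  have hlK : 0 ≤ Real.log K := Real.log_nonneg (by linarith)
  -- `43200 = 12 · 5 · 2 · 60 · 6`: time per draw and dimension, rounding of `n`, rounding of `m`,
  -- the constant in the acceptance probability, and `L ≤ 6 log X`.
  refine ⟨43200 * c ^ 2 * K * (Real.log K + 1) ^ 2, by positivity, ?_⟩
  intro d hd D hD u w₀ θ δ ν b m hθ0 hθ hangle hδ0 hδ1 hm hb hnoise hν Ω _ P _ Z hZ hlaw hind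
  have hprob : IsProbabilityMeasure D := hlaw 0 ▸
    Measure.isProbabilityMeasure_map (hZ 0).aemeasurable
  have hd3 : (3 : ℝ) ≤ d := by exact_mod_cast hd
  obtain ⟨-, -, -, -, hL1, -⟩ := ActivePerceptron.iteration_count_bounds hK hd3 hδ0 hδ1 hm
  set L := Real.log ((m : ℝ) ^ 2 / δ) with hL
  have hs0 : 0 < √(d : ℝ) := Real.sqrt_pos.2 (by linarith)
  have hc0 : 0 < c ^ 2 := by linarith
  have hL0 : 0 < L := by linarith
  have hb0 : 0 < b := by rw [hb]; positivity
  have hbs : b * √(d : ℝ) = θ / (2 * c ^ 2 * L) := by rw [hb]; field_simp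
  have hp : b * √(d : ℝ) / 30 = θ / (60 * c ^ 2 * L) := by rw [hbs, div_div]; congr 1; ring
  have hc2L : 3500000 ≤ c ^ 2 * L := by nlinarith
  have hpi := Real.pi_lt_d2
  have hp1 : b * √(d : ℝ) / 30 ≤ 1 := by
    rw [hp, div_le_one (by positivity)]
    linarith
  have hu : ‖(u : ActivePerceptron.Amb d)‖ = 1 := by simp
  have hw₀ : ‖(w₀ : ActivePerceptron.Amb d)‖ = 1 := by simp
  obtain ⟨hg1, hg2, hg3⟩ := ActivePerceptron.one_sub_cos_bounds hθ0 hθ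
  have hgap₀ := ActivePerceptron.gap_le_of_angle_le hu hw₀ hθ hangle
  obtain ⟨g, hg0, hg⟩ : ∃ g : ℝ, 0 < g ∧ g ^ 2 = 1 - Real.cos θ := by
    have : 0 < 1 - Real.cos θ := lt_of_lt_of_le (by positivity) hg1
    exact ⟨√(1 - Real.cos θ), Real.sqrt_pos.2 this, Real.sq_sqrt this.le⟩
  rw [← hg] at hg1 hg2 hg3 hgap₀
  have hg4 : g ≤ 1 := (sq_le_one_iff₀ hg0.le).1 hg3
  have hbg : b * √(d : ℝ) ≤ g / 4000 := by
    have h1 : θ / 3 ≤ g := by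
      rw [← sq_le_sq₀ (by positivity) hg0.le]
      nlinarith
    have h2 : b * √(d : ℝ) ≤ θ / 7000000 := by
      rw [hbs]
      exact div_le_div_of_nonneg_left hθ0.le (by norm_num) (by linarith)
    linarith
  have hN : D.real (ActivePerceptron.noiseSet u) ≤ b * √(d : ℝ) / 30 / 4000 := by
    obtain ⟨hν0, -, hν2⟩ := hnoise
    have h1 : D.real (ActivePerceptron.noiseSet u) ≤ ν :=
      ENNReal.toReal_le_of_le_ofReal hν0 hν2
    refine h1.trans (hν.trans ?_)
    rw [hp, div_div]
    refine div_le_div_of_nonneg_left hθ0.le (by positivity) ?_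
    -- What is needed is `60 · 4000 c² ≤ 384 c⁴`, and `c²` is in the millions.
    nlinarith [mul_le_mul_of_nonneg_right hc1 (by positivity : 0 ≤ c ^ 2 * L)]
  -- Four times the `m / p` draws that suffice on average when each draw is accepted with
  -- probability `p`; this beats the factor `2 ^ m` in `budgetBound`.
  set n := ⌈4 * m / (b * √(d : ℝ) / 30)⌉₊ with hn
  obtain ⟨E, hE, hPE, hsucc⟩ := ActivePerceptron.le_measure_trajectory_success_of_parameters hd hD
    hg0 hg4 hb0 hbg hN hZ hlaw hind hw₀ n m
    (ActivePerceptron.potential_add_budgetBound_le hd hK hδ0 hδ1 hθ0 hc1 hc2 hg0 hg1 hg2 hm hL hb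
      hp1 (Nat.le_ceil _) hgap₀)
  obtain ⟨hr1, hr2, hr3⟩ := ActivePerceptron.resource_bounds hK hd3 hδ0 hδ1 hθ0 hc1 rfl hm hL hp hp1
    hn
  refine ⟨E, hE, hPE, fun ω hω => ?_⟩
  obtain ⟨hdone, hgap⟩ := hsucc ω hω
  have hshift : (fun i => (fun i => Z i ω) ((⟨0, 0, 0⟩ : ActivePerceptron.Resources).draws + i)) =
      fun i => Z i ω := by
    funext i; simp
  obtain ⟨r, hrun, hdraws, hlabels, htime⟩ :=
    ActivePerceptron.modifiedPerceptron_apply_of_trajectory b (fun i => Z i ω) n m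
      (w₀ : ActivePerceptron.Amb d) ⟨0, 0, 0⟩ (by rw [hshift]; exact hdone)
  rw [hshift] at hrun
  simp only [zero_add] at hdraws hlabels htime
  have hdraws' : (r.draws : ℝ) ≤ n := by exact_mod_cast hdraws
  refine ⟨_, r, hrun, ?_, ?_, ?_, ?_⟩
  · refine ActivePerceptron.angle_le_half_of_gap_le hu ?_ hθ0 hθ (by rwa [← hg])
    rw [ActivePerceptron.norm_trajectory, hw₀]
  · rw [hlabels]
    exact hr1
  · refine le_trans ?_ hr3
    linarith [(Nat.cast_nonneg n : (0 : ℝ) ≤ n)]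
  · have h1 : (r.time : ℝ) ≤ n * (4 * d + 4) + m * (4 * d + 5) := by exact_mod_cast htime
    have h2 : (n : ℝ) * (4 * d + 4) ≤ n * (6 * d) :=
      mul_le_mul_of_nonneg_left (by linarith) (Nat.cast_nonneg n)
    -- Both cost terms are at most `6 d n`, by `m ≤ n` and `4 d + 5 ≤ 6 d`, which holds for `d ≥ 3`;
    -- this gives the factor 12.
    have h3 : (m : ℝ) * (4 * d + 5) ≤ n * (6 * d) :=
      mul_le_mul hr2 (by linarith) (by positivity) (Nat.cast_nonneg n)
    have h4 := mul_le_mul_of_nonneg_left hr3 (by positivity : (0 : ℝ) ≤ d)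
    refine le_trans (by linarith : (r.time : ℝ) ≤ d * (12 * n)) (h4.trans_eq ?_)
    ring
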